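/- **Model.** Let $m\ge 1$ and let $\Sigma,\Sigma'\in\mathbb C^{m\times m}$ be Hermitian positive definite: $\Sigma$ is the noise covariance assumed by the detector, $\Sigma'$ the true one. For every $n$ let $W\in\mathbb C^{m\times n}$ be the known signal matrix, with columns $w_1,\dots,w_n$ ($W$ may depend on $n$). Under $H_0$ the data are $Y=\operatorname{sign}(\mathrm{Re}\,N)+\imath\operatorname{sign}(\mathrm{Im}\,N)$, where the columns of $N\in\mathbb C^{m\times n}$ are i.i.d. circular complex Gaussian $\mathcal{CN}(0,\Sigma')$. Let $y_i\in\{\pm1\}^{2m}$ be the stacked real and imaginary parts of the $i$-th column of $Y$. Assume that $W\neq0$ for all large $n$ and that no column dominates: $$\max_{i\le n}\|w_i\|^2\Big/\sum_{i\le n}\|w_i\|^2\to0\qquad(n\to\infty).$$ **Detector.** For a vector $\mu$ and a covariance matrix $S$ let $P(\mu,S)$ be the probability that a $\mathcal N(\mu,S)$ vector has all its coordinates positive. Put $\Sigma_x=\frac12\begin{bmatrix}\mathrm{Re}\,\Sigma&-\mathrm{Im}\,\Sigma\\ \mathrm{Im}\,\Sigma&\mathrm{Re}\,\Sigma\end{bmatrix}$,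 let $D$ be its diagonal part and $C=D^{-1/2}\Sigma_xD^{-1/2}$; let $C'$ be obtained in the same way from $\Sigma'$. With $Z_i=\mathrm{diag}(y_i)$ and $\theta=[a,b]^T$, the log-likelihood of the assumed model (reflectivity $\beta=a+\imath b$) is $$\mathcal L(Y;\theta)=\sum_{i=1}^n\log P\big(Z_iD^{-1/2}[\mathrm{Re}(\beta w_i);\mathrm{Im}(\beta w_i)],\,Z_iCZ_i\big).$$ Rao's statistic is $T_R=s^TF^{-1}s$, where $s=\partial\mathcal L/\partial\theta|_{\theta=0}$ and $F$ is the Fisher information matrix of the assumed model at $\theta=0$. Let $\tau_1,\dots,\tau_\kappa$, $\kappa=2^{2m}$, be the elements of $\{\pm1\}^{2m}$, $\Gamma_j=\mathrm{diag}(\tau_j)$, $O_j=P(0,\Gamma_jC\Gamma_j)$, $O_j'=P(0,\Gamma_jC'\Gamma_j)$, $d_j=\Gamma_j\,\partial P(\mu,\Gamma_jC\Gamma_j)/\partial\mu|_{\mu=0}$, $a_i=D^{-1/2}[\mathrm{Re}\,w_i;\mathrm{Im}\,w_i]$, $b_i=D^{-1/2}[-\mathrm{Im}\,w_i;\mathrm{Re}\,w_i]$,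 $\Delta_1(i,j)=a_i^Td_j$, $\Delta_2(i,j)=b_i^Td_j$, $O=\mathrm{diag}(O_j)$, $G=\mathrm{diag}(O_j'/O_j^2)$, and $$\upsilon^2=\mathrm{tr}(\Delta_1^T\Delta_1O^{-1}),\qquad \upsilon_1^2=\mathrm{tr}(\Delta_1^T\Delta_1G),\qquad \mathbf w=[\mathrm w_1,\mathrm w_2]^T=s/\upsilon .$$ **Theorem.** For every $n$ with $W\ne0$: $\upsilon^2>0$ and $\upsilon_1^2>0$; $\upsilon^2=\mathrm{tr}(\Delta_2^T\Delta_2O^{-1})$ and $\upsilon_1^2=\mathrm{tr}(\Delta_2^T\Delta_2G)$; $T_R=\mathrm w_1^2+\mathrm w_2^2$; and under $H_0$ (with the true covariance $\Sigma'$) $\mathbb E[\mathbf w]=0$ and $\mathbb E[\mathbf w\mathbf w^T]=(\upsilon_1^2/\upsilon^2)I_2$. As $n\to\infty$, under $H_0$: 1. $\mathbf w$ is asymptotically $\mathcal N(0,(\upsilon_1^2/\upsilon^2)I_2)$: for every bounded continuous $f:\mathbb R^2\to\mathbb R$, $\mathbb E f(\mathbf w)-\int f\,d\mathcal N(0,(\upsilon_1^2/\upsilon^2)I_2)\to0$;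 moreover $(\upsilon/\upsilon_1)\mathbf w\to\mathcal N(0,I_2)$ in distribution. 2. $(\upsilon^2/\upsilon_1^2)\,T_R\to\chi^2_2$ in distribution. 3. The false-alarm probability $P_{fa}(\gamma)=\Pr\{T_R>\gamma\}$ satisfies $\sup_{\gamma\ge0}\big|P_{fa}(\gamma)-\exp(-\upsilon^2\gamma/(2\upsilon_1^2))\big|\to0$. -/

import Mathlib

open MeasureTheory ProbabilityTheory Filter Topology
open scoped Matrix ComplexOrder BoundedContinuousFunction

noncomputable section

namespace OneBit

/-! ### Gaussian orthant probabilities -/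

section Orthant

variable {ι : Type*} [Fintype ι] [DecidableEq ι]

/-- The density of the normal distribution with mean `μ` and (nonsingular) covariance `S`. -/
def gaussianDensity (μ : ι → ℝ) (S : Matrix ι ι ℝ) (x : ι → ℝ) : ℝ :=
  ((2 * Real.pi) ^ ((Fintype.card ι : ℝ) / 2) * Real.sqrt S.det)⁻¹ *
    Real.exp (-(1 / 2) * ((x - μ) ⬝ᵥ (S⁻¹ *ᵥ (x - μ))))

/-- The orthant probability: the integral of the normal density over the positive orthant. -/
def orthantProb (μ : ι → ℝ) (S : Matrix ι ι ℝ) : ℝ :=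
  ∫ x in {x : ι → ℝ | ∀ k, 0 < x k}, gaussianDensity μ S x

/-- The partial derivative of `f` with respect to the `k`-th coordinate, at the point `x`. -/
def partialDeriv (f : (ι → ℝ) → ℝ) (x : ι → ℝ) (k : ι) : ℝ :=
  deriv (fun t : ℝ => f (Function.update x k t)) (x k)

/-- `D ^ (-1/2)`, where `D` is the diagonal part of `S`. -/
def invSqrtDiag (S : Matrix ι ι ℝ) : Matrix ι ι ℝ :=
  Matrix.diagonal fun k => (Real.sqrt (S k k))⁻¹

/-- The coherence matrix `D ^ (-1/2) S D ^ (-1/2)` of a covariance matrix `S`. -/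
def coherence (S : Matrix ι ι ℝ) : Matrix ι ι ℝ :=
  invSqrtDiag S * S * invSqrtDiag S

end Orthant

/-! ### Real representation of the complex model

The real coordinates of a vector of `ℂ ^ m` are indexed by `Fin m ⊕ Fin m`: first the real parts,
then the imaginary parts. -/

section Model

variable {m n : ℕ}

/-- The stacked vector `[Re z; Im z]`. -/
def stack (z : Fin m → ℂ) : Fin m ⊕ Fin m → ℝ :=
  Sum.elim (fun k => (z k).re) (fun k => (z k).im)

/-- The covariance matrix of `[Re z; Im z]` when `z` is circular with covariance matrix `S`:
one half of `[Re S, -Im S; Im S, Re S]`. -/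
def stackedCov (S : Matrix (Fin m) (Fin m) ℂ) : Matrix (Fin m ⊕ Fin m) (Fin m ⊕ Fin m) ℝ :=
  (1 / 2 : ℝ) • Matrix.fromBlocks (S.map Complex.re) (-S.map Complex.im)
    (S.map Complex.im) (S.map Complex.re)

/-- The columns of the random matrix `N` are independent, each of them circular complex Gaussian
with mean zero and covariance matrix `S`. -/
def IsCircularGaussianNoise {Ω : Type*} [MeasurableSpace Ω] (N : Ω → Matrix (Fin m) (Fin n) ℂ)
    (S : Matrix (Fin m) (Fin m) ℂ) (P : Measure Ω) : Prop :=
  (∀ i : Fin n, HasLaw (fun ω => WithLp.toLp 2 (stack fun k => N ω k i))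
      (multivariateGaussian 0 (stackedCov S)) P) ∧
    iIndepFun (fun (i : Fin n) (ω : Ω) (k : Fin m) => N ω k i) P

/-- One-bit quantization: the signs of the real and of the imaginary part. -/
def quantize (z : ℂ) : ℂ := ⟨Real.sign z.re, Real.sign z.im⟩

/-- The stacked one-bit samples `y_1, ..., y_n` obtained from the columns of `X`. -/
def samples (X : Matrix (Fin m) (Fin n) ℂ) : Fin n → Fin m ⊕ Fin m → ℝ :=
  fun i => stack fun k => quantize (X k i)

/-! ### The detector built from the assumed noise covariance `S` and the known signal matrix `W` -/

/-- The mean of the `i`-th stacked received vector when the reflectivity is `θ 0 + θ 1 * I`. -/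
def signalMean (W : Matrix (Fin m) (Fin n) ℂ) (θ : Fin 2 → ℝ) (i : Fin n) :
    Fin m ⊕ Fin m → ℝ :=
  stack fun k => (⟨θ 0, θ 1⟩ : ℂ) * W k i

/-- The likelihood of the stacked one-bit sample `y` at time `i`: the orthant probability
`P(Z D^(-1/2) E[x_i], Z C Z)` with `Z = diag y` and `C` the coherence matrix. -/
def likelihood (S : Matrix (Fin m) (Fin m) ℂ) (W : Matrix (Fin m) (Fin n) ℂ) (i : Fin n)
    (y : Fin m ⊕ Fin m → ℝ) (θ : Fin 2 → ℝ) : ℝ :=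
  orthantProb (Matrix.diagonal y *ᵥ (invSqrtDiag (stackedCov S) *ᵥ signalMean W θ i))
    (Matrix.diagonal y * coherence (stackedCov S) * Matrix.diagonal y)

/-- The log-likelihood of the stacked one-bit samples `Y`. -/
def logLikelihood (S : Matrix (Fin m) (Fin m) ℂ) (W : Matrix (Fin m) (Fin n) ℂ)
    (Y : Fin n → Fin m ⊕ Fin m → ℝ) (θ : Fin 2 → ℝ) : ℝ :=
  ∑ i, Real.log (likelihood S W i (Y i) θ)

/-- The score: the gradient of the log-likelihood with respect to `θ`. -/
def score (S : Matrix (Fin m) (Fin m) ℂ) (W : Matrix (Fin m) (Fin n) ℂ)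
    (Y : Fin n → Fin m ⊕ Fin m → ℝ) (θ : Fin 2 → ℝ) : Fin 2 → ℝ :=
  partialDeriv (logLikelihood S W Y) θ

/-- The sign vectors `τ_j`, indexed by the `2 ^ (2 m)` binary words `j`. -/
def signVec (j : Fin m ⊕ Fin m → Bool) : Fin m ⊕ Fin m → ℝ :=
  fun k => if j k then 1 else -1

/-- The Fisher information matrix at `θ` of the assumed model: the expectation of
`score * scoreᵀ` when the sample matrix takes the value `(τ_{J 1}, ..., τ_{J n})` with probability
equal to its likelihood. -/
def fisherInformation (S : Matrix (Fin m) (Fin m) ℂ) (W : Matrix (Fin m) (Fin n) ℂ)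
    (θ : Fin 2 → ℝ) : Matrix (Fin 2) (Fin 2) ℝ :=
  ∑ J : Fin n → Fin m ⊕ Fin m → Bool,
    (∏ i, likelihood S W i (signVec (J i)) θ) •
      Matrix.vecMulVec (score S W (fun i => signVec (J i)) θ)
        (score S W (fun i => signVec (J i)) θ)

/-- Rao's test statistic for `θ = 0`. -/
def raoStatistic (S : Matrix (Fin m) (Fin m) ℂ) (W : Matrix (Fin m) (Fin n) ℂ)
    (Y : Fin n → Fin m ⊕ Fin m → ℝ) : ℝ :=
  score S W Y 0 ⬝ᵥ ((fisherInformation S W 0)⁻¹ *ᵥ score S W Y 0)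

/-- `C_j = Γ_j C Γ_j`, where `Γ_j = diag τ_j` and `C` is the coherence matrix. -/
def signedCoherence (S : Matrix (Fin m) (Fin m) ℂ) (j : Fin m ⊕ Fin m → Bool) :
    Matrix (Fin m ⊕ Fin m) (Fin m ⊕ Fin m) ℝ :=
  Matrix.diagonal (signVec j) * coherence (stackedCov S) * Matrix.diagonal (signVec j)

/-- The orthant probabilities `O_j = P(0, C_j)`. -/
def cellProb (S : Matrix (Fin m) (Fin m) ℂ) (j : Fin m ⊕ Fin m → Bool) : ℝ :=
  orthantProb 0 (signedCoherence S j)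

/-- The vectors `d_j = Γ_j ∂P(μ, C_j)/∂μ` at `μ = 0`. -/
def cellGrad (S : Matrix (Fin m) (Fin m) ℂ) (j : Fin m ⊕ Fin m → Bool) : Fin m ⊕ Fin m → ℝ :=
  Matrix.diagonal (signVec j) *ᵥ partialDeriv (fun μ => orthantProb μ (signedCoherence S j)) 0

/-- `Δ₁(i, j) = a_iᵀ d_j`, with `a_i = D^(-1/2) [Re w_i; Im w_i]`, `w_i` the `i`-th column
of `W`. -/
def delta₁ (S : Matrix (Fin m) (Fin m) ℂ) (W : Matrix (Fin m) (Fin n) ℂ) :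
    Matrix (Fin n) (Fin m ⊕ Fin m → Bool) ℝ :=
  Matrix.of fun i j => (invSqrtDiag (stackedCov S) *ᵥ
    Sum.elim (fun k => (W k i).re) (fun k => (W k i).im)) ⬝ᵥ cellGrad S j

/-- `Δ₂(i, j) = b_iᵀ d_j`, with `b_i = D^(-1/2) [-Im w_i; Re w_i]`. -/
def delta₂ (S : Matrix (Fin m) (Fin m) ℂ) (W : Matrix (Fin m) (Fin n) ℂ) :
    Matrix (Fin n) (Fin m ⊕ Fin m → Bool) ℝ :=
  Matrix.of fun i j => (invSqrtDiag (stackedCov S) *ᵥ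
    Sum.elim (fun k => -(W k i).im) (fun k => (W k i).re)) ⬝ᵥ cellGrad S j

/-- `O = diag (O_1, ..., O_κ)`. -/
def cellMatrix (S : Matrix (Fin m) (Fin m) ℂ) :
    Matrix (Fin m ⊕ Fin m → Bool) (Fin m ⊕ Fin m → Bool) ℝ :=
  Matrix.diagonal (cellProb S)

/-- `G = diag (O'_1 / O_1 ^ 2, ..., O'_κ / O_κ ^ 2)`, with `O'_j` computed from the true
covariance `S'`. -/
def mismatchMatrix (S S' : Matrix (Fin m) (Fin m) ℂ) :
    Matrix (Fin m ⊕ Fin m → Bool) (Fin m ⊕ Fin m → Bool) ℝ :=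
  Matrix.diagonal fun j => cellProb S' j / cellProb S j ^ 2

/-- `υ² = tr (Δ₁ᵀ Δ₁ O⁻¹)`. -/
def upsilonSq (S : Matrix (Fin m) (Fin m) ℂ) (W : Matrix (Fin m) (Fin n) ℂ) : ℝ :=
  ((delta₁ S W)ᵀ * delta₁ S W * (cellMatrix S)⁻¹).trace

/-- `υ₁² = tr (Δ₁ᵀ Δ₁ G)`. -/
def upsilonOneSq (S S' : Matrix (Fin m) (Fin m) ℂ) (W : Matrix (Fin m) (Fin n) ℂ) : ℝ :=
  ((delta₁ S W)ᵀ * delta₁ S W * mismatchMatrix S S').trace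

/-- The normalized score vector `w = υ⁻¹ ∂L/∂θ` at `θ = 0`. -/
def normalizedScore (S : Matrix (Fin m) (Fin m) ℂ) (W : Matrix (Fin m) (Fin n) ℂ)
    (Y : Fin n → Fin m ⊕ Fin m → ℝ) : EuclideanSpace ℝ (Fin 2) :=
  WithLp.toLp 2 ((Real.sqrt (upsilonSq S W))⁻¹ • score S W Y 0)

/-- The energy `‖w_i‖²` of the `i`-th column of `W`. -/
def columnEnergy (W : Matrix (Fin m) (Fin n) ℂ) (i : Fin n) : ℝ :=
  ∑ k, ‖W k i‖ ^ 2

end Model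

/-- The chi-square distribution with `k` degrees of freedom: the law of the sum of squares of `k`
independent standard normal variables. -/
def chiSquared (k : ℕ) : Measure ℝ :=
  (stdGaussian (EuclideanSpace ℝ (Fin k))).map fun x => ∑ i, x i ^ 2

instance instIsProbabilityMeasureChiSquared (k : ℕ) : IsProbabilityMeasure (chiSquared k) :=
  Measure.isProbabilityMeasure_map (by fun_prop)

end OneBit

end

open OneBit

/-!
# Rao's one-bit detector under noise covariance mismatch

The probability of a sign pattern is the mass of an orthant under a normal law. Moving the mean of a
nondegenerate normal law `N(0, C)` to `v` multiplies its density by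
`exp (⟨C⁻¹ v, x⟩ - ⟨C⁻¹ v, v⟩ / 2)`, so an orthant probability is, as a function of the mean and up
to a Gaussian factor, a moment generating function of `N(0, C)` restricted to the orthant
(`orthantProb_signed`). Its gradient at zero is therefore a first moment over the orthant
(`hasDerivAt_orthantProb_signed`), and the score of the data is a sum of independent terms, one for
each column, that depend only on the sign word of the column (`score_signVec`).

The exact statements rest on circularity. Multiplication by the imaginary unit commutes with the
stacked covariance, preserves the normal law and permutes the orthants. The permutation preserves
the orthant probabilities of the assumed and of the true covariance, and rotates the gradients; its
square is negation. Hence, under either set of orthant probabilities, the two components of each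
column's score are centered, uncorrelated and of equal variance
(`sum_mul_cellScore`, `sum_mul_cellScore_mul_cellScore`). With the assumed probabilities this says
that the Fisher information is `υ²` times the identity, and with the true ones that the score has
covariance `υ₁²` times the identity.

The traces `υ²` and `υ₁²` are comparable with the total energy of the signal
(`exists_sum_columnEnergy_le`, `exists_scoreVariance_le`). The lower bound needs the gradients to
span the whole space: the mean of `sign (x k) * ⟨u, x⟩` is a positive multiple of `(C u) k`, because
a reflection that preserves `N(0, C)` fixes `x k` and reverses the remainder of the regression of
`⟨u, x⟩` on `x k` (`integral_sign_mul_dotProduct`). So when no column dominates, the summands of the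
normalized score are uniformly small, and Lindeberg's comparison of characteristic functions
(`norm_prod_sum_mul_exp_sub_le`) together with Lévy's continuity theorem gives asymptotic normality.
The variance `υ₁² / υ²` need not converge but stays bounded, and passing to subsequences on which it
converges compares the law of the normalized score with the moving normal law
(`tendsto_integral_sub_multivariateGaussian`). The chi-square limit follows by continuous mapping;
its tail is `exp (-g / 2)`, and pointwise convergence of tails to a continuous one is uniform
(`eventually_abs_sub_exp_lt_of_antitone`).
-/

namespace OneBit

/-! ### Centered Gaussian measures on `ι → ℝ` -/

section CenteredGaussian

open scoped MatrixOrder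

variable {ι : Type*} [Fintype ι]

/-- The standard normal law on `ι → ℝ` has the product of the one-dimensional densities. -/
lemma pi_gaussianReal_eq_withDensity :
    Measure.pi (fun _ : ι => gaussianReal 0 1) =
      (volume : Measure (ι → ℝ)).withDensity
        fun x => ENNReal.ofReal (∏ k, gaussianPDFReal 0 1 (x k)) := by
  refine (Measure.pi_eq fun s hs => ?_)
  have hint : ∀ k, Integrable (gaussianPDFReal 0 1) (volume.restrict (s k)) :=
    fun k => (integrable_gaussianPDFReal 0 1).restrict
  rw [withDensity_apply _ (MeasurableSet.univ_pi hs), volume_pi, Measure.restrict_pi_pi,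
    ← ofReal_integral_eq_lintegral_ofReal (Integrable.fintype_prod hint)
      (Filter.Eventually.of_forall fun x =>
        Finset.prod_nonneg fun k _ => gaussianPDFReal_nonneg 0 1 (x k)),
    integral_fintype_prod_eq_prod (fun _ => gaussianPDFReal 0 1),
    ENNReal.ofReal_prod_of_nonneg fun k _ =>
      integral_nonneg fun x => gaussianPDFReal_nonneg 0 1 x]
  refine Finset.prod_congr rfl fun k _ => ?_
  rw [gaussianReal_apply_eq_integral _ one_ne_zero]

lemma prod_gaussianPDFReal (x : ι → ℝ) :
    ∏ k, gaussianPDFReal 0 1 (x k) =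
      ((2 * Real.pi) ^ ((Fintype.card ι : ℝ) / 2))⁻¹ * Real.exp (-(1 / 2) * (x ⬝ᵥ x)) := by
  simp only [gaussianPDFReal, sub_zero, NNReal.coe_one, mul_one, Finset.prod_mul_distrib,
    ← Real.exp_sum, Finset.prod_const, Finset.card_univ]
  congr 1
  · rw [inv_pow, Real.sqrt_eq_rpow, ← Real.rpow_mul_natCast (by positivity)]
    ring_nf
  · simp only [dotProduct, Finset.mul_sum]
    congr 1
    refine Finset.sum_congr rfl fun k _ => by ring

/-- The linear functional `x ↦ ⟨u, x⟩`, with its continuity. -/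
noncomputable def dotCLM (u : ι → ℝ) : (ι → ℝ) →L[ℝ] ℝ :=
  LinearMap.toContinuousLinearMap
    { toFun := fun x => u ⬝ᵥ x
      map_add' := fun x y => dotProduct_add u x y
      map_smul' := fun c x => by simp }

@[simp] lemma dotCLM_apply (u x : ι → ℝ) : dotCLM u x = u ⬝ᵥ x := rfl

lemma measurable_mulVec (A : Matrix ι ι ℝ) : Measurable fun x : ι → ℝ => A *ᵥ x :=
  (Continuous.matrix_mulVec continuous_const continuous_id).measurable

variable [DecidableEq ι]

/-- The normal law `N(0, S)` as a measure on the function space `ι → ℝ`, which carries the Lebesgue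
measure used for orthant probabilities. -/
noncomputable def centeredGaussian (S : Matrix ι ι ℝ) : Measure (ι → ℝ) :=
  (multivariateGaussian 0 S).map WithLp.ofLp

instance isProbabilityMeasure_centeredGaussian (S : Matrix ι ι ℝ) :
    IsProbabilityMeasure (centeredGaussian S) :=
  Measure.isProbabilityMeasure_map (by fun_prop)

lemma centeredGaussian_eq_map_pi (S : Matrix ι ι ℝ) :
    centeredGaussian S = (Measure.pi fun _ : ι => gaussianReal 0 1).map
      (Matrix.toLin' (CFC.sqrt S)) := by
  rw [centeredGaussian, multivariateGaussian, ← map_pi_eq_stdGaussian,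
    Measure.map_map (by fun_prop) (by fun_prop), Measure.map_map (by fun_prop) (by fun_prop)]
  congr 1
  ext x k
  simp

lemma sqrt_mul_sqrt {S : Matrix ι ι ℝ} (hS : S.PosDef) : CFC.sqrt S * CFC.sqrt S = S :=
  CFC.sqrt_mul_sqrt_self _ hS.posSemidef.nonneg

lemma transpose_sqrt (S : Matrix ι ι ℝ) : (CFC.sqrt S)ᵀ = CFC.sqrt S := by
  have h : IsSelfAdjoint (CFC.sqrt S) := (CFC.sqrt_nonneg S).isSelfAdjoint
  have := h.star_eq
  rwa [Matrix.star_eq_conjTranspose, Matrix.conjTranspose_eq_transpose_of_trivial] at this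

/-- A nondegenerate normal law has the usual density. -/
theorem centeredGaussian_eq_withDensity {S : Matrix ι ι ℝ} (hS : S.PosDef) :
    centeredGaussian S = (volume : Measure (ι → ℝ)).withDensity
      fun x => ENNReal.ofReal (gaussianDensity 0 S x) := by
  set B := CFC.sqrt S with hB
  have hBB : B * B = S := sqrt_mul_sqrt hS
  have hBT : Bᵀ = B := transpose_sqrt S
  have hdet2 : B.det * B.det = S.det := by rw [← Matrix.det_mul, hBB]
  have hdet : B.det ≠ 0 := by
    intro h
    rw [h, mul_zero] at hdet2
    exact hS.det_pos.ne hdet2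
  have hunit : IsUnit B.det := hdet.isUnit
  have hinv : B⁻¹ * B⁻¹ = S⁻¹ := by rw [← Matrix.mul_inv_rev, hBB]
  have hsqrt : Real.sqrt S.det = |B.det| := by rw [← hdet2, Real.sqrt_mul_self_eq_abs]
  have hmeas : Measurable (Matrix.toLin' B) :=
    (LinearMap.continuous_of_finiteDimensional _).measurable
  set ρ : (ι → ℝ) → ℝ := fun x => ∏ k, gaussianPDFReal 0 1 (x k) with hρ
  have hρm : Measurable ρ := by
    refine Finset.measurable_prod _ fun k _ => ?_
    exact (measurable_gaussianPDFReal 0 1).comp (measurable_pi_apply k)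
  have hinvm := measurable_mulVec B⁻¹
  have hcm : Measurable fun y => ENNReal.ofReal (ρ (B⁻¹ *ᵥ y)) := (hρm.comp hinvm).ennreal_ofReal
  ext A hA
  rw [centeredGaussian_eq_map_pi, Measure.map_apply hmeas hA, pi_gaussianReal_eq_withDensity,
    withDensity_apply _ (hmeas hA), withDensity_apply _ hA]
  have key : ∀ x, ENNReal.ofReal (ρ x) =
      (fun y => ENNReal.ofReal (ρ (B⁻¹ *ᵥ y))) (Matrix.toLin' B x) := by
    intro x
    simp [Matrix.mulVec_mulVec, Matrix.nonsing_inv_mul _ hunit]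
  calc ∫⁻ x in Matrix.toLin' B ⁻¹' A, ENNReal.ofReal (ρ x)
      = ∫⁻ x in Matrix.toLin' B ⁻¹' A,
          (fun y => ENNReal.ofReal (ρ (B⁻¹ *ᵥ y))) (Matrix.toLin' B x) := by
        simp_rw [← key]
    _ = ∫⁻ y in A, ENNReal.ofReal (ρ (B⁻¹ *ᵥ y)) ∂(Measure.map (Matrix.toLin' B) volume) := by
        rw [setLIntegral_map hA hcm hmeas]
    _ = ∫⁻ y in A, ENNReal.ofReal (gaussianDensity 0 S y) := by
        rw [Real.map_matrix_volume_pi_eq_smul_volume_pi hdet, Measure.restrict_smul,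
          lintegral_smul_measure, smul_eq_mul, ← lintegral_const_mul _ hcm]
        refine lintegral_congr fun y => ?_
        rw [← ENNReal.ofReal_mul (abs_nonneg _)]
        congr 1
        rw [hρ, gaussianDensity]
        simp only [prod_gaussianPDFReal, sub_zero]
        have : (B⁻¹ *ᵥ y) ⬝ᵥ (B⁻¹ *ᵥ y) = y ⬝ᵥ (S⁻¹ *ᵥ y) := by
          rw [← hinv, ← Matrix.mulVec_mulVec, Matrix.dotProduct_mulVec y,
            ← Matrix.mulVec_transpose, Matrix.transpose_nonsing_inv, hBT]
        rw [this, hsqrt, abs_inv, mul_inv]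
        ring

open scoped RealInnerProductSpace in
/-- Linear images of centered normal laws are centered normal laws. -/
theorem map_mulVec_centeredGaussian {S : Matrix ι ι ℝ} (hS : S.PosSemidef) (A : Matrix ι ι ℝ) :
    (centeredGaussian S).map (fun x => A *ᵥ x) = centeredGaussian (A * S * Aᵀ) := by
  have hS' : (A * S * Aᵀ).PosSemidef := by
    simpa [Matrix.conjTranspose_eq_transpose_of_trivial] using hS.mul_mul_conjTranspose_same A
  have hlaw : (multivariateGaussian 0 S).map (Matrix.toEuclideanCLM (𝕜 := ℝ) A) =
      multivariateGaussian 0 (A * S * Aᵀ) := by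
    refine Measure.ext_of_charFun (funext fun t => ?_)
    rw [charFun_multivariateGaussian hS', charFun_apply, integral_map (by fun_prop) (by fun_prop)]
    have h := charFun_multivariateGaussian (μ := 0) hS (Matrix.toEuclideanCLM (𝕜 := ℝ) Aᵀ t)
    rw [charFun_apply] at h
    have hin : ∀ x : EuclideanSpace ℝ ι, ⟪Matrix.toEuclideanCLM (𝕜 := ℝ) A x, t⟫ =
        ⟪x, Matrix.toEuclideanCLM (𝕜 := ℝ) Aᵀ t⟫ := by
      intro x
      rw [real_inner_comm, Matrix.inner_toEuclideanCLM, Matrix.inner_toEuclideanCLM,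
        Matrix.dotProduct_mulVec, ← Matrix.mulVec_transpose, dotProduct_comm]
    simp_rw [hin, h]
    simp only [inner_zero_right, Matrix.ofLp_toEuclideanCLM]
    congr 4
    rw [Matrix.dotProduct_mulVec, ← Matrix.mulVec_transpose, Matrix.dotProduct_mulVec,
      ← Matrix.mulVec_transpose, Matrix.mulVec_mulVec]
    rw [Matrix.dotProduct_mulVec, ← Matrix.mulVec_transpose]
    simp [Matrix.transpose_mul, Matrix.mul_assoc]
  rw [centeredGaussian, centeredGaussian, ← hlaw,
    Measure.map_map (measurable_mulVec A) (by fun_prop),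
    Measure.map_map (by fun_prop) (by fun_prop)]
  rfl

instance isGaussian_centeredGaussian (S : Matrix ι ι ℝ) : IsGaussian (centeredGaussian S) :=
  inferInstanceAs (IsGaussian ((multivariateGaussian 0 S).map
    (PiLp.continuousLinearEquiv 2 ℝ fun _ : ι => ℝ)))

/-- Exponential moments of all orders exist under a normal law. -/
lemma integrable_exp_dotProduct (S : Matrix ι ι ℝ) (u : ι → ℝ) :
    Integrable (fun x => Real.exp (u ⬝ᵥ x)) (centeredGaussian S) := by
  have h : Integrable (fun y => Real.exp (1 * y)) ((centeredGaussian S).map (dotCLM u)) := by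
    rw [IsGaussian.map_eq_gaussianReal]
    exact integrable_exp_mul_gaussianReal 1
  rw [integrable_map_measure (by fun_prop) (by fun_prop)] at h
  simpa [Function.comp_def] using h

lemma integrable_dotProduct (S : Matrix ι ι ℝ) (u : ι → ℝ) :
    Integrable (fun x => u ⬝ᵥ x) (centeredGaussian S) :=
  (dotCLM u).integrable_comp IsGaussian.integrable_id

/-- Coordinates of a nondegenerate normal vector have laws without atoms. -/
lemma ae_coord_ne_zero {S : Matrix ι ι ℝ} (hS : S.PosDef) :
    ∀ᵐ x ∂centeredGaussian S, ∀ k, x k ≠ 0 := by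
  rw [ae_all_iff]
  intro k
  have hmap : (centeredGaussian S).map (fun x => x k) = gaussianReal 0 (S k k).toNNReal := by
    have := (measurePreserving_eval_multivariateGaussian (μ := 0) hS.posSemidef (i := k)).map_eq
    rw [centeredGaussian, Measure.map_map (by fun_prop) (by fun_prop)]
    simpa [Function.comp_def] using this
  have hne : (S k k).toNNReal ≠ 0 := by simpa using hS.diag_pos
  have := nullSingletonClass_gaussianReal (μ := 0) hne
  have h : ∀ᵐ y ∂(centeredGaussian S).map (fun x => x k), y ≠ 0 := by
    rw [hmap, ae_iff]
    simp
  exact ae_of_ae_map (f := fun x : ι → ℝ => x k) (measurable_pi_apply k).aemeasurable h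

end CenteredGaussian

/-! ### Orthant probabilities as exponential moments of a centered normal law -/

section OrthantProb

variable {ι : Type*} [Fintype ι] [DecidableEq ι]

/-- The open orthant with signs `τ`. -/
def signedOrthant (τ : ι → ℝ) : Set (ι → ℝ) := {x | ∀ k, 0 < τ k * x k}

omit [Fintype ι] [DecidableEq ι] in
lemma signedOrthant_eq_iInter (τ : ι → ℝ) :
    signedOrthant τ = ⋂ k, {x : ι → ℝ | 0 < τ k * x k} := by
  ext x; simp [signedOrthant]

omit [DecidableEq ι] in
lemma isOpen_signedOrthant (τ : ι → ℝ) : IsOpen (signedOrthant τ) := by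
  rw [signedOrthant_eq_iInter]
  exact isOpen_iInter_of_finite fun k => isOpen_lt (by fun_prop) (by fun_prop)

omit [DecidableEq ι] in
lemma measurableSet_signedOrthant (τ : ι → ℝ) : MeasurableSet (signedOrthant τ) :=
  (isOpen_signedOrthant τ).measurableSet

lemma gaussianDensity_nonneg (μ : ι → ℝ) (S : Matrix ι ι ℝ) (x : ι → ℝ) :
    0 ≤ gaussianDensity μ S x := by
  unfold gaussianDensity
  positivity

lemma measurable_gaussianDensity (S : Matrix ι ι ℝ) : Measurable (gaussianDensity 0 S) := by
  have h : Continuous fun x : ι → ℝ => (x - 0) ⬝ᵥ (S⁻¹ *ᵥ (x - 0)) :=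
    Continuous.dotProduct (by fun_prop) (Continuous.matrix_mulVec continuous_const (by fun_prop))
  unfold gaussianDensity
  exact (by fun_prop : Continuous fun x : ι → ℝ =>
    ((2 * Real.pi) ^ ((Fintype.card ι : ℝ) / 2) * Real.sqrt S.det)⁻¹ *
      Real.exp (-(1 / 2) * ((x - 0) ⬝ᵥ (S⁻¹ *ᵥ (x - 0))))).measurable

lemma dotProduct_inv_mulVec_comm {S : Matrix ι ι ℝ} (hS : S.PosDef) (x y : ι → ℝ) :
    x ⬝ᵥ (S⁻¹ *ᵥ y) = (S⁻¹ *ᵥ x) ⬝ᵥ y := by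
  have h : (S⁻¹)ᵀ = S⁻¹ := by
    have := hS.inv.isHermitian.eq
    rwa [Matrix.conjTranspose_eq_transpose_of_trivial] at this
  rw [Matrix.dotProduct_mulVec, ← Matrix.mulVec_transpose, h]

/-- Shifting the mean of a normal law is an exponential change of density. -/
lemma gaussianDensity_eq_mul_exp {S : Matrix ι ι ℝ} (hS : S.PosDef) (μ x : ι → ℝ) :
    gaussianDensity μ S x = Real.exp (-(1 / 2) * ((S⁻¹ *ᵥ μ) ⬝ᵥ μ)) *
      (gaussianDensity 0 S x * Real.exp ((S⁻¹ *ᵥ μ) ⬝ᵥ x)) := by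
  have hexp : -(1 / 2) * ((x - μ) ⬝ᵥ (S⁻¹ *ᵥ (x - μ))) =
      -(1 / 2) * ((S⁻¹ *ᵥ μ) ⬝ᵥ μ) + (-(1 / 2) * (x ⬝ᵥ (S⁻¹ *ᵥ x)) + (S⁻¹ *ᵥ μ) ⬝ᵥ x) := by
    have h1 := dotProduct_inv_mulVec_comm hS μ x
    have h2 := dotProduct_comm x (S⁻¹ *ᵥ μ)
    have h3 := dotProduct_comm μ (S⁻¹ *ᵥ μ)
    rw [Matrix.mulVec_sub, sub_dotProduct, dotProduct_sub, dotProduct_sub, h1, h2, h3]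
    ring
  simp only [gaussianDensity, sub_zero]
  rw [hexp, Real.exp_add, Real.exp_add]
  ring

theorem orthantProb_eq_integral_exp {S : Matrix ι ι ℝ} (hS : S.PosDef) (μ : ι → ℝ) :
    orthantProb μ S = Real.exp (-(1 / 2) * ((S⁻¹ *ᵥ μ) ⬝ᵥ μ)) *
      ∫ x in {x : ι → ℝ | ∀ k, 0 < x k}, Real.exp ((S⁻¹ *ᵥ μ) ⬝ᵥ x) ∂centeredGaussian S := by
  have hm : MeasurableSet {x : ι → ℝ | ∀ k, 0 < x k} := by
    simpa [signedOrthant] using measurableSet_signedOrthant (fun _ : ι => (1 : ℝ))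
  rw [centeredGaussian_eq_withDensity hS, orthantProb,
    setIntegral_withDensity_eq_setIntegral_toReal_smul
      (measurable_gaussianDensity S).ennreal_ofReal (by simp) _ hm, ← integral_const_mul]
  refine integral_congr_ae (Filter.Eventually.of_forall fun x => ?_)
  simp only [ENNReal.toReal_ofReal (gaussianDensity_nonneg 0 S x), smul_eq_mul]
  exact gaussianDensity_eq_mul_exp hS μ x

variable {τ : ι → ℝ} (hτ : ∀ k, τ k * τ k = 1)

include hτ

lemma diagonal_sign_mul_self : Matrix.diagonal τ * Matrix.diagonal τ = 1 := by
  rw [Matrix.diagonal_mul_diagonal]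
  simp [hτ]

lemma posDef_signed {S : Matrix ι ι ℝ} (hS : S.PosDef) :
    (Matrix.diagonal τ * S * Matrix.diagonal τ).PosDef := by
  have hu : IsUnit (Matrix.diagonal τ) :=
    IsUnit.of_mul_eq_one _ (diagonal_sign_mul_self hτ)
  have := (Matrix.IsUnit.posDef_star_left_conjugate_iff hu (x := S)).2 hS
  simpa [Matrix.star_eq_conjTranspose, Matrix.diagonal_conjTranspose] using this

lemma inv_signed (S : Matrix ι ι ℝ) :
    (Matrix.diagonal τ * S * Matrix.diagonal τ)⁻¹ =
      Matrix.diagonal τ * S⁻¹ * Matrix.diagonal τ := by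
  have : (Matrix.diagonal τ)⁻¹ = Matrix.diagonal τ :=
    Matrix.inv_eq_left_inv (diagonal_sign_mul_self hτ)
  rw [Matrix.mul_inv_rev, Matrix.mul_inv_rev, this, Matrix.mul_assoc]

/-- Flipping signs turns the positive orthant into the orthant with signs `τ`. -/
theorem orthantProb_signed {S : Matrix ι ι ℝ} (hS : S.PosDef) (v : ι → ℝ) :
    orthantProb (Matrix.diagonal τ *ᵥ v) (Matrix.diagonal τ * S * Matrix.diagonal τ) =
      Real.exp (-(1 / 2) * ((S⁻¹ *ᵥ v) ⬝ᵥ v)) *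
        ∫ x in signedOrthant τ, Real.exp ((S⁻¹ *ᵥ v) ⬝ᵥ x) ∂centeredGaussian S := by
  have hm : MeasurableSet {x : ι → ℝ | ∀ k, 0 < x k} := by
    simpa [signedOrthant] using measurableSet_signedOrthant (fun _ : ι => (1 : ℝ))
  have hdot : ∀ x y : ι → ℝ, (Matrix.diagonal τ *ᵥ x) ⬝ᵥ (Matrix.diagonal τ *ᵥ y) = x ⬝ᵥ y := by
    intro x y
    simp only [dotProduct, Matrix.mulVec_diagonal]
    refine Finset.sum_congr rfl fun k _ => ?_
    linear_combination (x k * y k) * hτ k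
  have hinv : (Matrix.diagonal τ * S * Matrix.diagonal τ)⁻¹ *ᵥ (Matrix.diagonal τ *ᵥ v) =
      Matrix.diagonal τ *ᵥ (S⁻¹ *ᵥ v) := by
    rw [inv_signed hτ, Matrix.mulVec_mulVec, Matrix.mul_assoc, diagonal_sign_mul_self hτ,
      Matrix.mul_one, Matrix.mulVec_mulVec]
  have hmap := map_mulVec_centeredGaussian hS.posSemidef (Matrix.diagonal τ)
  rw [Matrix.diagonal_transpose] at hmap
  rw [orthantProb_eq_integral_exp (posDef_signed hτ hS), hinv, hdot, ← hmap,
    setIntegral_map hm (Continuous.aestronglyMeasurable (by unfold dotProduct; fun_prop))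
      (measurable_mulVec _).aemeasurable]
  simp only [hdot]
  congr 2
  have hset : (fun x => Matrix.diagonal τ *ᵥ x) ⁻¹' {x : ι → ℝ | ∀ k, 0 < x k} =
      signedOrthant τ := by
    ext x
    simp [signedOrthant, Matrix.mulVec_diagonal]
  rw [hset]

theorem orthantProb_signed_zero {S : Matrix ι ι ℝ} (hS : S.PosDef) :
    orthantProb 0 (Matrix.diagonal τ * S * Matrix.diagonal τ) =
      (centeredGaussian S).real (signedOrthant τ) := by
  have h := orthantProb_signed hτ hS 0
  simpa using h

lemma centeredGaussian_real_signedOrthant_pos {S : Matrix ι ι ℝ} (hS : S.PosDef) :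
    0 < (centeredGaussian S).real (signedOrthant τ) := by
  have hvol : volume (signedOrthant τ) ≠ 0 :=
    ((isOpen_signedOrthant τ).measure_pos volume ⟨τ, fun k => by simp [hτ k]⟩).ne'
  have hpos : ∀ x, 0 < gaussianDensity 0 S x := by
    intro x
    have := Real.sqrt_pos.2 hS.det_pos
    unfold gaussianDensity
    positivity
  have hac : (volume : Measure (ι → ℝ)) ≪ centeredGaussian S := by
    rw [centeredGaussian_eq_withDensity hS]
    exact withDensity_absolutelyContinuous'
      (measurable_gaussianDensity S).ennreal_ofReal.aemeasurable
      (Filter.Eventually.of_forall fun x => by simpa using hpos x)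
  rw [measureReal_def, ENNReal.toReal_pos_iff]
  exact ⟨pos_iff_ne_zero.2 fun h => hvol (hac h), measure_lt_top _ _⟩

/-- The derivative, at mean zero, of an orthant probability along a direction in which the mean
moves. The exponential representation makes it the first moment of a restricted normal law. -/
theorem hasDerivAt_orthantProb_signed {S : Matrix ι ι ℝ} (hS : S.PosDef) (v : ι → ℝ) :
    HasDerivAt (fun t : ℝ => orthantProb (Matrix.diagonal τ *ᵥ (t • v))
        (Matrix.diagonal τ * S * Matrix.diagonal τ))
      (∫ x in signedOrthant τ, (S⁻¹ *ᵥ v) ⬝ᵥ x ∂centeredGaussian S) 0 := by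
  set ν := (centeredGaussian S).restrict (signedOrthant τ) with hν
  set u := S⁻¹ *ᵥ v with hu
  have hset : integrableExpSet (fun x => u ⬝ᵥ x) ν = Set.univ := by
    refine Set.eq_univ_of_forall fun t => ?_
    have := (integrable_exp_dotProduct S (t • u)).restrict (s := signedOrthant τ)
    simpa [integrableExpSet, smul_dotProduct] using this
  have hmgf : HasDerivAt (mgf (fun x => u ⬝ᵥ x) ν) (∫ x, u ⬝ᵥ x ∂ν) 0 := by
    have := hasDerivAt_mgf (X := fun x => u ⬝ᵥ x) (μ := ν) (t := 0) (by simp [hset])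
    simpa using this
  have hexp : HasDerivAt (fun t : ℝ => Real.exp (-(1 / 2) * (t ^ 2 * (u ⬝ᵥ v)))) 0 0 := by
    have h1 : HasDerivAt (fun t : ℝ => -(1 / 2) * (t ^ 2 * (u ⬝ᵥ v))) 0 0 := by
      have := (((hasDerivAt_pow 2 (0 : ℝ)).mul_const (u ⬝ᵥ v)).const_mul (-(1 / 2)))
      simpa using this
    simpa using h1.exp
  have hprod := hexp.mul hmgf
  refine (hprod.congr_deriv ?_).congr_of_eventuallyEq (Filter.Eventually.of_forall fun t => ?_)
  · simp
  · beta_reduce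
    rw [orthantProb_signed hτ hS, Matrix.mulVec_smul, ← hu, ← hν]
    simp only [Pi.mul_apply, mgf, smul_dotProduct, dotProduct_smul, smul_eq_mul]
    ring_nf

omit hτ

/-- The reflection that fixes the coordinate `x k` and reverses the part of `x` that is
uncorrelated with it, under the covariance matrix `S`. -/
noncomputable def coordReflection (S : Matrix ι ι ℝ) (k : ι) : Matrix ι ι ℝ :=
  (2 / S k k) • Matrix.vecMulVec (fun l => S l k) (Pi.single k 1) - 1

lemma coordReflection_mulVec (S : Matrix ι ι ℝ) (k : ι) (x : ι → ℝ) :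
    coordReflection S k *ᵥ x = (2 / S k k * x k) • (fun l => S l k) - x := by
  rw [coordReflection, Matrix.sub_mulVec, Matrix.smul_mulVec, Matrix.one_mulVec,
    Matrix.vecMulVec_mulVec]
  ext l
  simp
  ring

lemma coordReflection_mul_mul_transpose {S : Matrix ι ι ℝ} (hS : S.PosDef) (k : ι) :
    coordReflection S k * S * (coordReflection S k)ᵀ = S := by
  have hsymm : ∀ a b, S a b = S b a := fun a b => by
    simpa using (hS.isHermitian.apply b a)
  have hk : S k k ≠ 0 := hS.diag_pos.ne'
  have h1 : coordReflection S k * S =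
      (2 / S k k) • Matrix.vecMulVec (fun l => S l k) (fun l => S l k) - S := by
    rw [coordReflection, Matrix.sub_mul, Matrix.one_mul, Matrix.smul_mul, Matrix.vecMulVec_mul]
    congr 3
    ext l
    simp [hsymm k l]
  rw [h1, coordReflection, Matrix.transpose_sub, Matrix.transpose_smul, Matrix.transpose_one,
    Matrix.transpose_vecMulVec, Matrix.mul_sub, Matrix.mul_one, Matrix.sub_mul, Matrix.smul_mul,
    Matrix.mul_smul, Matrix.mul_smul, Matrix.mul_vecMulVec, Matrix.mul_vecMulVec]
  ext a b
  simp [Matrix.vecMulVec_apply]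
  field_simp
  ring

/-- Regressing `⟨u, x⟩` on `x k` leaves a remainder that the reflection of `coordReflection`
reverses, so that only the regression coefficient contributes. -/
theorem integral_sign_mul_dotProduct {S : Matrix ι ι ℝ} (hS : S.PosDef) (u : ι → ℝ) (k : ι) :
    ∫ x, Real.sign (x k) * (u ⬝ᵥ x) ∂centeredGaussian S =
      (S *ᵥ u) k * ((∫ x, |x k| ∂centeredGaussian S) / S k k) := by
  have hk : S k k ≠ 0 := hS.diag_pos.ne'
  have hsymm : ∀ a b, S a b = S b a := fun a b => by
    simpa using (hS.isHermitian.apply b a)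
  have hmap := map_mulVec_centeredGaussian hS.posSemidef (coordReflection S k)
  rw [coordReflection_mul_mul_transpose hS] at hmap
  have hsm : Measurable Real.sign := by
    refine Measurable.ite measurableSet_Iio measurable_const
      (Measurable.ite measurableSet_Ioi measurable_const measurable_const)
  have hmeas : Measurable fun x : ι → ℝ => Real.sign (x k) * (u ⬝ᵥ x) := by
    refine (hsm.comp (measurable_pi_apply k)).mul (Continuous.measurable ?_)
    unfold dotProduct
    fun_prop
  have habs : Integrable (fun x : ι → ℝ => |x k|) (centeredGaussian S) := by
    have := (integrable_dotProduct S (Pi.single k 1)).abs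
    simpa using this
  have hint : Integrable (fun x : ι → ℝ => Real.sign (x k) * (u ⬝ᵥ x)) (centeredGaussian S) := by
    refine (integrable_dotProduct S u).mono hmeas.aestronglyMeasurable
      (Filter.Eventually.of_forall fun x => ?_)
    rw [norm_mul]
    refine mul_le_of_le_one_left (norm_nonneg _) ?_
    obtain h | h | h := Real.sign_apply_eq (x k) <;> simp [h]
  have hflip : ∀ x : ι → ℝ, Real.sign ((coordReflection S k *ᵥ x) k) *
      (u ⬝ᵥ (coordReflection S k *ᵥ x)) =
      2 * (S *ᵥ u) k / S k k * |x k| - Real.sign (x k) * (u ⬝ᵥ x) := by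
    intro x
    have h1 : (coordReflection S k *ᵥ x) k = x k := by
      rw [coordReflection_mulVec]
      simp
      field_simp
      ring
    have h2 : u ⬝ᵥ (fun l => S l k) = (S *ᵥ u) k := by
      rw [dotProduct_comm, Matrix.mulVec]
      congr 1
      ext l
      exact hsymm l k
    have h3 : Real.sign (x k) * x k = |x k| := by
      rcases lt_trichotomy (x k) 0 with h | h | h
      · rw [Real.sign_of_neg h, abs_of_neg h]; ring
      · simp [h]
      · rw [Real.sign_of_pos h, abs_of_pos h]; ring
    rw [h1, coordReflection_mulVec, dotProduct_sub, dotProduct_smul, h2, ← h3, smul_eq_mul]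
    ring
  have hself : ∫ x, Real.sign (x k) * (u ⬝ᵥ x) ∂centeredGaussian S =
      2 * (S *ᵥ u) k / S k k * ∫ x, |x k| ∂centeredGaussian S -
        ∫ x, Real.sign (x k) * (u ⬝ᵥ x) ∂centeredGaussian S := by
    conv_lhs => rw [← hmap]
    rw [integral_map (measurable_mulVec _).aemeasurable hmeas.aestronglyMeasurable]
    simp only [hflip]
    rw [integral_sub (habs.const_mul _) hint, integral_const_mul]
  field_simp at hself ⊢
  linarith

lemma integral_abs_coord_pos {S : Matrix ι ι ℝ} (hS : S.PosDef) (k : ι) :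
    0 < ∫ x, |x k| ∂centeredGaussian S := by
  have habs : Integrable (fun x : ι → ℝ => |x k|) (centeredGaussian S) := by
    have := (integrable_dotProduct S (Pi.single k 1)).abs
    simpa using this
  rw [integral_pos_iff_support_of_nonneg (fun x => abs_nonneg _) habs]
  have h : Function.support (fun x : ι → ℝ => |x k|) =ᵐ[centeredGaussian S] Set.univ := by
    rw [eventuallyEq_univ]
    filter_upwards [ae_coord_ne_zero hS] with x hx
    simpa using hx k
  rw [measure_congr h]
  simp

end OrthantProb

/-! ### Sign words and the orthants of the one-bit samples -/

section Words

variable {m : ℕ}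

lemma signVec_mul_self (j : Fin m ⊕ Fin m → Bool) (k : Fin m ⊕ Fin m) :
    signVec j k * signVec j k = 1 := by
  cases h : j k <;> simp [signVec, h]

/-- The binary word that records which coordinates of `x` are positive. -/
noncomputable def wordOf (x : Fin m ⊕ Fin m → ℝ) : Fin m ⊕ Fin m → Bool :=
  fun k => decide (0 < x k)

lemma measurable_wordOf : Measurable (wordOf (m := m)) := by
  refine measurable_pi_iff.2 fun k => ?_
  refine measurable_to_bool ?_
  have : (fun x : Fin m ⊕ Fin m → ℝ => wordOf x k) ⁻¹' {true} = {x | 0 < x k} := by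
    ext x; simp [wordOf]
  rw [this]
  exact measurableSet_lt measurable_const (measurable_pi_apply k)

lemma signVec_wordOf_mul_pos {x : Fin m ⊕ Fin m → ℝ} (hx : ∀ k, x k ≠ 0) (k : Fin m ⊕ Fin m) :
    0 < signVec (wordOf x) k * x k := by
  rcases lt_or_gt_of_ne (hx k) with h | h
  · simp [signVec, wordOf, h, h.not_gt]
  · simp [signVec, wordOf, h]

lemma mem_signedOrthant_signVec {x : Fin m ⊕ Fin m → ℝ} (hx : ∀ k, x k ≠ 0)
    (j : Fin m ⊕ Fin m → Bool) : x ∈ signedOrthant (signVec j) ↔ wordOf x = j := by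
  constructor
  · intro h
    funext k
    have hk := h k
    cases hj : j k
    · simp only [signVec, hj] at hk
      simp only [wordOf, decide_eq_false_iff_not, not_lt]
      simp at hk
      exact hk.le
    · simpa [signVec, wordOf, hj] using hk
  · rintro rfl
    exact signVec_wordOf_mul_pos hx

lemma sign_eq_signVec_wordOf {x : Fin m ⊕ Fin m → ℝ} (hx : ∀ k, x k ≠ 0) (k : Fin m ⊕ Fin m) :
    Real.sign (x k) = signVec (wordOf x) k := by
  rcases lt_or_gt_of_ne (hx k) with h | h
  · simp [signVec, wordOf, h.not_gt, Real.sign_of_neg h]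
  · simp [signVec, wordOf, h, Real.sign_of_pos h]

end Words

/-! ### The real representation of a circular covariance matrix -/

section StackedCov

variable {m : ℕ}

lemma stackedCov_mulVec_stack (S : Matrix (Fin m) (Fin m) ℂ) (z : Fin m → ℂ) :
    stackedCov S *ᵥ stack z = (1 / 2 : ℝ) • stack (S *ᵥ z) := by
  rw [stackedCov, Matrix.smul_mulVec]
  congr 1
  ext k
  rcases k with k | k
  · simp [stack, Matrix.mulVec, dotProduct, Matrix.fromBlocks, Fintype.sum_sum_type,
      Finset.sum_add_distrib, sub_eq_add_neg]
  · simp [stack, Matrix.mulVec, dotProduct, Matrix.fromBlocks, Fintype.sum_sum_type,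
      Finset.sum_add_distrib, add_comm]

lemma stack_dotProduct_stack (z w : Fin m → ℂ) :
    stack z ⬝ᵥ stack w = (star z ⬝ᵥ w).re := by
  simp [stack, dotProduct, Fintype.sum_sum_type, Finset.sum_add_distrib]

lemma exists_stack_eq (x : Fin m ⊕ Fin m → ℝ) : ∃ z : Fin m → ℂ, stack z = x :=
  ⟨fun k => ⟨x (Sum.inl k), x (Sum.inr k)⟩, by ext k; rcases k with k | k <;> rfl⟩

lemma posDef_stackedCov {S : Matrix (Fin m) (Fin m) ℂ} (hS : S.PosDef) :
    (stackedCov S).PosDef := by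
  rw [Matrix.posDef_iff_dotProduct_mulVec]
  constructor
  · have hre : ∀ a b, (S a b).re = (S b a).re := fun a b => by
      rw [← hS.isHermitian.apply a b]; simp
    have him : ∀ a b, (S a b).im = -(S b a).im := fun a b => by
      rw [← hS.isHermitian.apply a b]; simp
    ext a b
    rcases a with a | a <;> rcases b with b | b
    · simp [stackedCov, hre b a]
    · simp [stackedCov, him b a]
    · simp [stackedCov, him b a]
    · simp [stackedCov, hre b a]
  · intro x hx
    obtain ⟨z, rfl⟩ := exists_stack_eq x
    have hz : z ≠ 0 := by
      rintro rfl
      exact hx (by ext k; rcases k with k | k <;> simp [stack])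
    have := hS.dotProduct_mulVec_pos hz
    rw [star_trivial, stackedCov_mulVec_stack, dotProduct_smul, stack_dotProduct_stack, smul_eq_mul]
    have := (Complex.lt_def.1 this).1
    simp only [Complex.zero_re] at this
    linarith

section

variable {ι : Type*} [Fintype ι] [DecidableEq ι]

omit [Fintype ι] [DecidableEq ι] in
lemma invSqrtDiag_pos {S : Matrix ι ι ℝ} (hS : S.PosDef) (k : ι) : 0 < (Real.sqrt (S k k))⁻¹ :=
  inv_pos.2 (Real.sqrt_pos.2 hS.diag_pos)

lemma posDef_coherence {S : Matrix ι ι ℝ} (hS : S.PosDef) : (coherence S).PosDef := by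
  have hu : IsUnit (invSqrtDiag S) := by
    rw [invSqrtDiag, Matrix.isUnit_diagonal, Pi.isUnit_iff]
    exact fun k => (invSqrtDiag_pos hS k).ne'.isUnit
  have := (Matrix.IsUnit.posDef_star_left_conjugate_iff hu (x := S)).2 hS
  simpa [coherence, invSqrtDiag, Matrix.star_eq_conjTranspose,
    Matrix.diagonal_conjTranspose] using this

end

/-- The real matrix of multiplication by the imaginary unit. -/
def imagUnit (m : ℕ) : Matrix (Fin m ⊕ Fin m) (Fin m ⊕ Fin m) ℝ :=
  Matrix.fromBlocks 0 (-1) 1 0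

lemma imagUnit_mulVec (x : Fin m ⊕ Fin m → ℝ) :
    imagUnit m *ᵥ x = Sum.elim (fun k => -x (Sum.inr k)) (fun k => x (Sum.inl k)) := by
  ext k
  rcases k with k | k <;> simp [imagUnit, Matrix.fromBlocks_mulVec, Matrix.neg_mulVec]

lemma imagUnit_mul_transpose : imagUnit m * (imagUnit m)ᵀ = 1 := by
  simp [imagUnit, Matrix.fromBlocks_transpose, Matrix.fromBlocks_multiply]

lemma imagUnit_dotProduct (x y : Fin m ⊕ Fin m → ℝ) :
    (imagUnit m *ᵥ x) ⬝ᵥ (imagUnit m *ᵥ y) = x ⬝ᵥ y := by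
  simp [imagUnit_mulVec, dotProduct, Fintype.sum_sum_type, add_comm]

lemma imagUnit_mulVec_imagUnit_mulVec (x : Fin m ⊕ Fin m → ℝ) :
    imagUnit m *ᵥ (imagUnit m *ᵥ x) = -x := by
  ext k
  rcases k with k | k <;> simp [imagUnit_mulVec]

lemma commute_imagUnit_stackedCov (S : Matrix (Fin m) (Fin m) ℂ) :
    Commute (imagUnit m) (stackedCov S) := by
  rw [Commute, SemiconjBy, stackedCov, imagUnit, Matrix.mul_smul, Matrix.smul_mul,
    Matrix.fromBlocks_multiply, Matrix.fromBlocks_multiply]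
  simp

lemma commute_imagUnit_invSqrtDiag (S : Matrix (Fin m) (Fin m) ℂ) :
    Commute (imagUnit m) (invSqrtDiag (stackedCov S)) := by
  have h : invSqrtDiag (stackedCov S) =
      Matrix.fromBlocks (Matrix.diagonal fun k => (Real.sqrt ((1 / 2) * (S k k).re))⁻¹) 0 0
        (Matrix.diagonal fun k => (Real.sqrt ((1 / 2) * (S k k).re))⁻¹) := by
    rw [Matrix.fromBlocks_diagonal, invSqrtDiag]
    congr 1
    ext k
    rcases k with k | k <;> simp [stackedCov]
  rw [Commute, SemiconjBy, h, imagUnit, Matrix.fromBlocks_multiply, Matrix.fromBlocks_multiply]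
  simp

lemma commute_imagUnit_coherence (S : Matrix (Fin m) (Fin m) ℂ) :
    Commute (imagUnit m) (coherence (stackedCov S)) :=
  ((commute_imagUnit_invSqrtDiag S).mul_right (commute_imagUnit_stackedCov S)).mul_right
    (commute_imagUnit_invSqrtDiag S)

/-- Multiplying by the imaginary unit preserves the law of a circular Gaussian vector. -/
lemma map_imagUnit_centeredGaussian {S : Matrix (Fin m) (Fin m) ℂ} (hS : S.PosDef) :
    (centeredGaussian (coherence (stackedCov S))).map (fun x => imagUnit m *ᵥ x) =
      centeredGaussian (coherence (stackedCov S)) := by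
  rw [map_mulVec_centeredGaussian (posDef_coherence (posDef_stackedCov hS)).posSemidef,
    (commute_imagUnit_coherence S).eq, Matrix.mul_assoc, imagUnit_mul_transpose, Matrix.mul_one]

/-- The permutation of the sign words induced by multiplication by the imaginary unit. -/
def rotateWord : Equiv.Perm (Fin m ⊕ Fin m → Bool) where
  toFun j := Sum.elim (fun k => !j (Sum.inr k)) (fun k => j (Sum.inl k))
  invFun j := Sum.elim (fun k => j (Sum.inr k)) (fun k => !j (Sum.inl k))
  left_inv j := by ext k; rcases k with k | k <;> simp
  right_inv j := by ext k; rcases k with k | k <;> simp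

lemma imagUnit_mulVec_mem_signedOrthant (x : Fin m ⊕ Fin m → ℝ) (j : Fin m ⊕ Fin m → Bool) :
    imagUnit m *ᵥ x ∈ signedOrthant (signVec (rotateWord j)) ↔ x ∈ signedOrthant (signVec j) := by
  have h : ∀ k : Fin m, (0 : ℝ) < signVec (rotateWord j) (Sum.inl k) * -x (Sum.inr k) ↔
      0 < signVec j (Sum.inr k) * x (Sum.inr k) := by
    intro k
    cases hj : j (Sum.inr k) <;> simp [signVec, rotateWord, hj]
  simp only [signedOrthant, Set.mem_ofPred_eq, imagUnit_mulVec, Sum.forall, Sum.elim_inl,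
    Sum.elim_inr, h]
  exact and_comm

end StackedCov

/-! ### Cell probabilities and cell gradients -/

section Cells

variable {m : ℕ} {S : Matrix (Fin m) (Fin m) ℂ}

lemma cellProb_eq (hS : S.PosDef) (j : Fin m ⊕ Fin m → Bool) :
    cellProb S j =
      (centeredGaussian (coherence (stackedCov S))).real (signedOrthant (signVec j)) :=
  orthantProb_signed_zero (signVec_mul_self j) (posDef_coherence (posDef_stackedCov hS))

lemma cellProb_pos (hS : S.PosDef) (j : Fin m ⊕ Fin m → Bool) : 0 < cellProb S j := by
  rw [cellProb_eq hS]
  exact centeredGaussian_real_signedOrthant_pos (signVec_mul_self j)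
    (posDef_coherence (posDef_stackedCov hS))

lemma dotProduct_cellGrad (hS : S.PosDef) (v : Fin m ⊕ Fin m → ℝ) (j : Fin m ⊕ Fin m → Bool) :
    v ⬝ᵥ cellGrad S j = ∫ x in signedOrthant (signVec j),
      ((coherence (stackedCov S))⁻¹ *ᵥ v) ⬝ᵥ x ∂centeredGaussian (coherence (stackedCov S)) := by
  have hC := posDef_coherence (posDef_stackedCov hS)
  set C := coherence (stackedCov S) with hCdef
  have hcoord : ∀ k, cellGrad S j k = ∫ x in signedOrthant (signVec j),
      (C⁻¹ *ᵥ Pi.single k 1) ⬝ᵥ x ∂centeredGaussian C := by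
    intro k
    have hfun : (fun t : ℝ => orthantProb (Function.update 0 k t) (signedCoherence S j)) =
        fun t : ℝ => orthantProb
          (Matrix.diagonal (signVec j) *ᵥ (t • (signVec j k • Pi.single k 1)))
          (Matrix.diagonal (signVec j) * C * Matrix.diagonal (signVec j)) := by
      funext t
      congr 1
      ext l
      rw [Matrix.mulVec_diagonal]
      by_cases hl : l = k
      · subst hl
        simp only [Function.update_self, Pi.smul_apply, Pi.single_eq_same, smul_eq_mul]
        linear_combination (-t) * signVec_mul_self j l
      · simp [Function.update_of_ne hl, Pi.single_eq_of_ne hl]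
    have hd := hasDerivAt_orthantProb_signed (signVec_mul_self j) hC
      (signVec j k • Pi.single k 1)
    rw [cellGrad, Matrix.mulVec_diagonal, partialDeriv, Pi.zero_apply, hfun, hd.deriv,
      Matrix.mulVec_smul]
    simp only [smul_dotProduct, smul_eq_mul]
    rw [integral_const_mul, ← mul_assoc, signVec_mul_self, one_mul]
  have hv : ∀ x : Fin m ⊕ Fin m → ℝ,
      (C⁻¹ *ᵥ v) ⬝ᵥ x = ∑ k, v k * ((C⁻¹ *ᵥ Pi.single k 1) ⬝ᵥ x) := by
    intro x
    simp only [← dotProduct_inv_mulVec_comm hC, single_dotProduct, one_mul]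
    rfl
  simp only [hv]
  rw [integral_finsetSum _ fun k _ =>
    ((integrable_dotProduct C (C⁻¹ *ᵥ Pi.single k 1)).const_mul (v k)).restrict]
  simp only [integral_const_mul, dotProduct, hcoord]

lemma cellProb_rotateWord (hS : S.PosDef) (j : Fin m ⊕ Fin m → Bool) :
    cellProb S (rotateWord j) = cellProb S j := by
  rw [cellProb_eq hS, cellProb_eq hS]
  conv_lhs => rw [← map_imagUnit_centeredGaussian hS]
  rw [map_measureReal_apply (measurable_mulVec _) (measurableSet_signedOrthant _)]
  congr 1
  ext x
  exact imagUnit_mulVec_mem_signedOrthant x j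

lemma imagUnit_mulVec_dotProduct_cellGrad (hS : S.PosDef) (v : Fin m ⊕ Fin m → ℝ)
    (j : Fin m ⊕ Fin m → Bool) :
    (imagUnit m *ᵥ v) ⬝ᵥ cellGrad S (rotateWord j) = v ⬝ᵥ cellGrad S j := by
  rw [dotProduct_cellGrad hS, dotProduct_cellGrad hS]
  have hC := posDef_coherence (posDef_stackedCov hS)
  have hcomm : (coherence (stackedCov S))⁻¹ * imagUnit m =
      imagUnit m * (coherence (stackedCov S))⁻¹ := by
    have hu : IsUnit (coherence (stackedCov S)).det :=
      (Matrix.isUnit_iff_isUnit_det _).1 hC.isUnit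
    have h := (commute_imagUnit_coherence S).eq
    calc _ = (coherence (stackedCov S))⁻¹ * (imagUnit m * coherence (stackedCov S)) *
          (coherence (stackedCov S))⁻¹ := by
          rw [Matrix.mul_assoc, Matrix.mul_assoc, Matrix.mul_nonsing_inv _ hu, Matrix.mul_one]
      _ = _ := by
          rw [h, ← Matrix.mul_assoc, Matrix.nonsing_inv_mul _ hu, Matrix.one_mul]
  conv_lhs => rw [← map_imagUnit_centeredGaussian hS]
  rw [setIntegral_map (measurableSet_signedOrthant _)
    (Continuous.aestronglyMeasurable (by unfold dotProduct; fun_prop))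
    (measurable_mulVec _).aemeasurable, Matrix.mulVec_mulVec, hcomm, ← Matrix.mulVec_mulVec]
  simp only [imagUnit_dotProduct]
  congr 2
  ext x
  exact imagUnit_mulVec_mem_signedOrthant x j

lemma dotProduct_cellGrad_rotateWord (hS : S.PosDef) (v : Fin m ⊕ Fin m → ℝ)
    (j : Fin m ⊕ Fin m → Bool) :
    v ⬝ᵥ cellGrad S (rotateWord j) = -((imagUnit m *ᵥ v) ⬝ᵥ cellGrad S j) := by
  have h := imagUnit_mulVec_dotProduct_cellGrad hS (imagUnit m *ᵥ v) j
  rw [imagUnit_mulVec_imagUnit_mulVec, neg_dotProduct] at h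
  linarith

section Moments

variable {q : (Fin m ⊕ Fin m → Bool) → ℝ}

/-- The quadratic moments of the cell gradients along `v` and along its rotation agree. -/
lemma sum_mul_sq_imagUnit (hS : S.PosDef) (hq : ∀ j, q (rotateWord j) = q j)
    (v : Fin m ⊕ Fin m → ℝ) :
    ∑ j, q j * ((imagUnit m *ᵥ v) ⬝ᵥ cellGrad S j) ^ 2 = ∑ j, q j * (v ⬝ᵥ cellGrad S j) ^ 2 := by
  rw [← Equiv.sum_comp rotateWord]
  simp only [hq, imagUnit_mulVec_dotProduct_cellGrad hS]

/-- A rotation-invariant weighting makes the cell gradients along `v` and along its rotation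
uncorrelated. -/
lemma sum_mul_mul_imagUnit (hS : S.PosDef) (hq : ∀ j, q (rotateWord j) = q j)
    (v : Fin m ⊕ Fin m → ℝ) :
    ∑ j, q j * ((v ⬝ᵥ cellGrad S j) * ((imagUnit m *ᵥ v) ⬝ᵥ cellGrad S j)) = 0 := by
  have h : ∑ j, q j * ((v ⬝ᵥ cellGrad S j) * ((imagUnit m *ᵥ v) ⬝ᵥ cellGrad S j)) =
      -∑ j, q j * ((v ⬝ᵥ cellGrad S j) * ((imagUnit m *ᵥ v) ⬝ᵥ cellGrad S j)) := by
    conv_lhs => rw [← Equiv.sum_comp rotateWord]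
    rw [← Finset.sum_neg_distrib]
    refine Finset.sum_congr rfl fun j _ => ?_
    rw [hq, imagUnit_mulVec_dotProduct_cellGrad hS, dotProduct_cellGrad_rotateWord hS]
    ring
  linarith

lemma sum_mul_dotProduct_cellGrad (hS : S.PosDef) (hq : ∀ j, q (rotateWord j) = q j)
    (v : Fin m ⊕ Fin m → ℝ) : ∑ j, q j * (v ⬝ᵥ cellGrad S j) = 0 := by
  have h1 : ∑ j, q j * (v ⬝ᵥ cellGrad S j) =
      -∑ j, q j * ((imagUnit m *ᵥ v) ⬝ᵥ cellGrad S j) := by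
    conv_lhs => rw [← Equiv.sum_comp rotateWord]
    simp only [hq, dotProduct_cellGrad_rotateWord hS, mul_neg, Finset.sum_neg_distrib]
  have h2 : ∑ j, q j * ((imagUnit m *ᵥ v) ⬝ᵥ cellGrad S j) = ∑ j, q j * (v ⬝ᵥ cellGrad S j) := by
    conv_lhs => rw [← Equiv.sum_comp rotateWord]
    simp only [hq, imagUnit_mulVec_dotProduct_cellGrad hS]
  linarith

end Moments

lemma ae_mem_signedOrthant_iff (hS : S.PosDef) :
    ∀ᵐ x ∂centeredGaussian (coherence (stackedCov S)), ∀ j : Fin m ⊕ Fin m → Bool,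
      x ∈ signedOrthant (signVec j) ↔ wordOf x = j := by
  filter_upwards [ae_coord_ne_zero (posDef_coherence (posDef_stackedCov hS))] with x hx
  exact mem_signedOrthant_signVec hx

lemma sum_cellProb (hS : S.PosDef) : ∑ j, cellProb S j = 1 := by
  set G := centeredGaussian (coherence (stackedCov S))
  have : IsProbabilityMeasure (G.map wordOf) :=
    Measure.isProbabilityMeasure_map measurable_wordOf.aemeasurable
  have h : ∀ j, cellProb S j = (G.map wordOf).real {j} := by
    intro j
    rw [cellProb_eq hS, map_measureReal_apply measurable_wordOf (measurableSet_singleton j)]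
    refine measureReal_congr ?_
    filter_upwards [ae_mem_signedOrthant_iff hS] with x hx
    exact propext (hx j)
  simp only [h]
  rw [sum_measureReal_singleton]
  simp

/-- The sign-weighted cell gradients recover the coordinates of a direction, up to positive factors.
This is the nondegeneracy of the one-bit model. -/
theorem sum_signVec_mul_dotProduct_cellGrad (hS : S.PosDef) (v : Fin m ⊕ Fin m → ℝ)
    (k : Fin m ⊕ Fin m) :
    ∑ j, signVec j k * (v ⬝ᵥ cellGrad S j) =
      v k * ((∫ x, |x k| ∂centeredGaussian (coherence (stackedCov S))) /
        coherence (stackedCov S) k k) := by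
  have hC := posDef_coherence (posDef_stackedCov hS)
  set C := coherence (stackedCov S) with hCdef
  have hCv : C *ᵥ (C⁻¹ *ᵥ v) = v := by
    rw [Matrix.mulVec_mulVec,
      Matrix.mul_nonsing_inv _ ((Matrix.isUnit_iff_isUnit_det _).1 hC.isUnit),
      Matrix.one_mulVec]
  have hsign := integral_sign_mul_dotProduct hC (C⁻¹ *ᵥ v) k
  rw [hCv] at hsign
  rw [← hsign]
  simp only [dotProduct_cellGrad hS, ← hCdef, ← integral_const_mul]
  simp only [← integral_indicator (measurableSet_signedOrthant _)]
  rw [← integral_finsetSum _ fun j _ => ((integrable_dotProduct C (C⁻¹ *ᵥ v)).const_mul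
    (signVec j k)).indicator (measurableSet_signedOrthant _)]
  refine integral_congr_ae ?_
  filter_upwards [ae_mem_signedOrthant_iff hS, ae_coord_ne_zero hC] with x hx hx0
  rw [sign_eq_signVec_wordOf hx0, Finset.sum_eq_single (wordOf x)]
  · rw [Set.indicator_of_mem ((hx _).2 rfl)]
  · intro j _ hj
    rw [Set.indicator_of_notMem fun h => hj ((hx j).1 h).symm]
  · simp

end Cells

/-! ### Moments under product weights on a finite product -/

section ProductWeights

variable {α : Type*} [Fintype α] {n : ℕ} {p : α → ℝ}

lemma sum_prod_eq_prod_sum [DecidableEq α] {R : Type*} [CommRing R] (g : Fin n → α → R) :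
    ∑ J : Fin n → α, ∏ i, g i (J i) = ∏ i, ∑ j, g i j := by
  rw [Finset.prod_univ_sum, Fintype.piFinset_univ]

/-- A sum of centered variables has mean zero under product weights. -/
lemma sum_prod_mul_sum {u : Fin n → α → ℝ} (hu : ∀ i, ∑ j, p j * u i j = 0) :
    ∑ J : Fin n → α, (∏ i, p (J i)) * ∑ i, u i (J i) = 0 := by
  classical
  simp only [Finset.mul_sum]
  rw [Finset.sum_comm]
  refine Finset.sum_eq_zero fun i _ => ?_
  have h : ∀ J : Fin n → α, (∏ k, p (J k)) * u i (J i) =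
      ∏ k, p (J k) * (if k = i then u k (J k) else 1) := fun J => by
    rw [Finset.prod_mul_distrib, Finset.prod_ite_eq' Finset.univ i, if_pos (Finset.mem_univ i)]
  simp only [h]
  rw [sum_prod_eq_prod_sum fun k j => p j * (if k = i then u k j else 1)]
  exact Finset.prod_eq_zero (Finset.mem_univ i) (by simpa using hu i)

/-- Under product weights of total mass one, a centered sum and another sum correlate only through
their diagonal terms. -/
lemma sum_prod_mul_sum_mul_sum (hp : ∑ j, p j = 1) {u v : Fin n → α → ℝ}
    (hu : ∀ i, ∑ j, p j * u i j = 0) :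
    ∑ J : Fin n → α, (∏ i, p (J i)) * ((∑ i, u i (J i)) * ∑ i, v i (J i)) =
      ∑ i, ∑ j, p j * (u i j * v i j) := by
  classical
  have hexpand : ∀ J : Fin n → α, (∏ i, p (J i)) * ((∑ i, u i (J i)) * ∑ i, v i (J i)) =
      ∑ i, ∑ l, (∏ k, p (J k)) * (u i (J i) * v l (J l)) := fun J => by
    rw [Finset.sum_mul_sum]
    simp only [Finset.mul_sum]
  simp only [hexpand]
  rw [Finset.sum_comm]
  refine Finset.sum_congr rfl fun i _ => ?_
  rw [Finset.sum_comm]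
  have h : ∀ l, ∀ J : Fin n → α, (∏ k, p (J k)) * (u i (J i) * v l (J l)) =
      ∏ k, p (J k) * ((if k = i then u k (J k) else 1) * (if k = l then v k (J k) else 1)) :=
    fun l J => by
      rw [Finset.prod_mul_distrib, Finset.prod_mul_distrib, Finset.prod_ite_eq' Finset.univ i,
        Finset.prod_ite_eq' Finset.univ l, if_pos (Finset.mem_univ i), if_pos (Finset.mem_univ l)]
  simp only [h]
  have h2 : ∀ l, ∑ J : Fin n → α, ∏ k, p (J k) *
      ((if k = i then u k (J k) else 1) * (if k = l then v k (J k) else 1)) =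
      ∏ k, ∑ j, p j * ((if k = i then u k j else 1) * (if k = l then v k j else 1)) := fun l =>
    sum_prod_eq_prod_sum fun k j =>
      p j * ((if k = i then u k j else 1) * (if k = l then v k j else 1))
  simp only [h2]
  rw [Finset.sum_eq_single i]
  · rw [Finset.prod_eq_single i]
    · simp
    · intro k _ hk
      simp [hk, hp]
    · simp
  · intro l _ hl
    refine Finset.prod_eq_zero (Finset.mem_univ i) ?_
    simpa [hl.symm] using hu i
  · simp

end ProductWeights

/-! ### The score and the Fisher information at the null hypothesis -/

section Score

variable {m n : ℕ} {S : Matrix (Fin m) (Fin m) ℂ}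

/-- The direction in which the normalized mean of the `i`-th sample moves with the real (`c = 0`)
or imaginary (`c = 1`) part of the reflectivity: the vector `a_i` or `b_i`. -/
noncomputable def meanDirection (S : Matrix (Fin m) (Fin m) ℂ) (W : Matrix (Fin m) (Fin n) ℂ)
    (c : Fin 2) (i : Fin n) : Fin m ⊕ Fin m → ℝ :=
  invSqrtDiag (stackedCov S) *ᵥ signalMean W (Pi.single c 1) i

/-- The contribution to the `c`-th score component of the `i`-th sample, when it is the sign vector
of the word `j`. -/
noncomputable def cellScore (S : Matrix (Fin m) (Fin m) ℂ) (W : Matrix (Fin m) (Fin n) ℂ)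
    (c : Fin 2) (i : Fin n) (j : Fin m ⊕ Fin m → Bool) : ℝ :=
  (meanDirection S W c i ⬝ᵥ cellGrad S j) / cellProb S j

lemma signalMean_zero_apply (W : Matrix (Fin m) (Fin n) ℂ) (i : Fin n) :
    signalMean W (Pi.single 0 1) i = Sum.elim (fun k => (W k i).re) (fun k => (W k i).im) := by
  ext k
  rcases k with k | k <;> simp [signalMean, stack]

lemma signalMean_one_apply (W : Matrix (Fin m) (Fin n) ℂ) (i : Fin n) :
    signalMean W (Pi.single 1 1) i = Sum.elim (fun k => -(W k i).im) (fun k => (W k i).re) := by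
  ext k
  rcases k with k | k <;> simp [signalMean, stack]

lemma signalMean_update (W : Matrix (Fin m) (Fin n) ℂ) (c : Fin 2) (t : ℝ) (i : Fin n) :
    signalMean W (Function.update 0 c t) i = t • signalMean W (Pi.single c 1) i := by
  ext k
  fin_cases c <;> rcases k with k | k <;> simp [signalMean, stack]

lemma signalMean_zero (W : Matrix (Fin m) (Fin n) ℂ) (i : Fin n) : signalMean W 0 i = 0 := by
  ext k
  rcases k with k | k <;> simp [signalMean, stack]

lemma meanDirection_one (W : Matrix (Fin m) (Fin n) ℂ) (i : Fin n) :
    meanDirection S W 1 i = imagUnit m *ᵥ meanDirection S W 0 i := by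
  rw [meanDirection, meanDirection, Matrix.mulVec_mulVec, (commute_imagUnit_invSqrtDiag S).eq,
    ← Matrix.mulVec_mulVec, imagUnit_mulVec, signalMean_one_apply, signalMean_zero_apply]
  rfl

lemma delta₁_apply (W : Matrix (Fin m) (Fin n) ℂ) (i : Fin n) (j : Fin m ⊕ Fin m → Bool) :
    delta₁ S W i j = meanDirection S W 0 i ⬝ᵥ cellGrad S j := by
  rw [meanDirection, signalMean_zero_apply]; rfl

lemma delta₂_apply (W : Matrix (Fin m) (Fin n) ℂ) (i : Fin n) (j : Fin m ⊕ Fin m → Bool) :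
    delta₂ S W i j = meanDirection S W 1 i ⬝ᵥ cellGrad S j := by
  rw [meanDirection, signalMean_one_apply]; rfl

lemma likelihood_signVec_zero (W : Matrix (Fin m) (Fin n) ℂ) (i : Fin n)
    (j : Fin m ⊕ Fin m → Bool) : likelihood S W i (signVec j) 0 = cellProb S j := by
  simp [likelihood, signalMean_zero, cellProb, signedCoherence]

/-- On sign words, the score at the null hypothesis is a sum of cell scores. -/
theorem score_signVec (hS : S.PosDef) (W : Matrix (Fin m) (Fin n) ℂ)
    (J : Fin n → Fin m ⊕ Fin m → Bool) (c : Fin 2) :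
    score S W (fun i => signVec (J i)) 0 c = ∑ i, cellScore S W c i (J i) := by
  have hC := posDef_coherence (posDef_stackedCov hS)
  have hfun : (fun t : ℝ => logLikelihood S W (fun i => signVec (J i)) (Function.update 0 c t)) =
      fun t : ℝ => ∑ i, Real.log (orthantProb
        (Matrix.diagonal (signVec (J i)) *ᵥ (t • meanDirection S W c i))
        (Matrix.diagonal (signVec (J i)) * coherence (stackedCov S) *
          Matrix.diagonal (signVec (J i)))) := by
    funext t
    simp only [logLikelihood, likelihood, signalMean_update, Matrix.mulVec_smul, meanDirection]
  have hd : HasDerivAt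
      (fun t : ℝ => logLikelihood S W (fun i => signVec (J i)) (Function.update 0 c t))
      (∑ i, cellScore S W c i (J i)) 0 := by
    rw [hfun]
    refine HasDerivAt.fun_sum fun i _ => ?_
    have h := hasDerivAt_orthantProb_signed (signVec_mul_self (J i)) hC (meanDirection S W c i)
    rw [← dotProduct_cellGrad hS] at h
    have h0 : orthantProb (Matrix.diagonal (signVec (J i)) *ᵥ ((0 : ℝ) • meanDirection S W c i))
        (Matrix.diagonal (signVec (J i)) * coherence (stackedCov S) *
          Matrix.diagonal (signVec (J i))) = cellProb S (J i) := by
      rw [zero_smul, Matrix.mulVec_zero]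
      rfl
    have hlog := h.log (by rw [h0]; exact (cellProb_pos hS (J i)).ne')
    rwa [h0] at hlog
  rw [score, partialDeriv, Pi.zero_apply]
  exact hd.deriv

lemma sum_mul_cellScore (hS : S.PosDef) {p : (Fin m ⊕ Fin m → Bool) → ℝ}
    (hp : ∀ j, p (rotateWord j) = p j) (W : Matrix (Fin m) (Fin n) ℂ) (c : Fin 2) (i : Fin n) :
    ∑ j, p j * cellScore S W c i j = 0 := by
  have h := sum_mul_dotProduct_cellGrad (q := fun j => p j / cellProb S j) hS
    (fun j => by simp only [hp, cellProb_rotateWord hS]) (meanDirection S W c i)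
  rw [← h]
  refine Finset.sum_congr rfl fun j _ => ?_
  rw [cellScore]
  ring

lemma sum_mul_cellScore_mul_cellScore (hS : S.PosDef) {p : (Fin m ⊕ Fin m → Bool) → ℝ}
    (hp : ∀ j, p (rotateWord j) = p j) (W : Matrix (Fin m) (Fin n) ℂ) (c c' : Fin 2) (i : Fin n) :
    ∑ j, p j * (cellScore S W c i j * cellScore S W c' i j) =
      if c = c' then ∑ j, p j * cellScore S W 0 i j ^ 2 else 0 := by
  have hq : ∀ j, (fun j => p j / cellProb S j ^ 2) (rotateWord j) =
      (fun j => p j / cellProb S j ^ 2) j := fun j => by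
    simp only [hp, cellProb_rotateWord hS]
  have hsq := sum_mul_sq_imagUnit (q := fun j => p j / cellProb S j ^ 2) hS hq
    (meanDirection S W 0 i)
  have hmul := sum_mul_mul_imagUnit (q := fun j => p j / cellProb S j ^ 2) hS hq
    (meanDirection S W 0 i)
  rw [← meanDirection_one] at hsq hmul
  have h : ∀ c c' : Fin 2, ∑ j, p j * (cellScore S W c i j * cellScore S W c' i j) =
      ∑ j, p j / cellProb S j ^ 2 * ((meanDirection S W c i ⬝ᵥ cellGrad S j) *
        (meanDirection S W c' i ⬝ᵥ cellGrad S j)) := fun c c' => by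
    refine Finset.sum_congr rfl fun j _ => ?_
    simp only [cellScore]
    ring
  simp only [pow_two (cellScore S W 0 i _), h]
  simp only [pow_two (_ ⬝ᵥ _)] at hsq
  have hfin : ∀ c : Fin 2, c = 0 ∨ c = 1 := by decide
  rcases hfin c with rfl | rfl <;> rcases hfin c' with rfl | rfl
  · rw [if_pos rfl]
  · rw [if_neg zero_ne_one, hmul]
  · rw [if_neg one_ne_zero, ← hmul]
    exact Finset.sum_congr rfl fun j _ => by ring
  · rw [if_pos rfl, hsq]

/-- The common variance of the two score components when the sign words have the probabilities
`p`. -/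
noncomputable def scoreVariance (p : (Fin m ⊕ Fin m → Bool) → ℝ) (S : Matrix (Fin m) (Fin m) ℂ)
    (W : Matrix (Fin m) (Fin n) ℂ) : ℝ :=
  ∑ i, ∑ j, p j * cellScore S W 0 i j ^ 2

/-- If the samples are independent with rotation-invariant word probabilities `p`, then the score
has covariance matrix `scoreVariance p S W • 1`. -/
lemma sum_prod_mul_score_mul_score (hS : S.PosDef) {p : (Fin m ⊕ Fin m → Bool) → ℝ}
    (hp : ∀ j, p (rotateWord j) = p j) (hp1 : ∑ j, p j = 1) (W : Matrix (Fin m) (Fin n) ℂ)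
    (c c' : Fin 2) :
    ∑ J : Fin n → Fin m ⊕ Fin m → Bool, (∏ i, p (J i)) *
      (score S W (fun i => signVec (J i)) 0 c * score S W (fun i => signVec (J i)) 0 c') =
      (scoreVariance p S W • (1 : Matrix (Fin 2) (Fin 2) ℝ)) c c' := by
  simp only [score_signVec hS]
  rw [sum_prod_mul_sum_mul_sum hp1 fun i => sum_mul_cellScore hS hp W c i]
  simp only [sum_mul_cellScore_mul_cellScore hS hp, scoreVariance, Matrix.smul_apply,
    Matrix.one_apply]
  split_ifs <;> simp

lemma sum_prod_mul_score (hS : S.PosDef) {p : (Fin m ⊕ Fin m → Bool) → ℝ}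
    (hp : ∀ j, p (rotateWord j) = p j) (W : Matrix (Fin m) (Fin n) ℂ) (c : Fin 2) :
    ∑ J : Fin n → Fin m ⊕ Fin m → Bool, (∏ i, p (J i)) *
      score S W (fun i => signVec (J i)) 0 c = 0 := by
  simp only [score_signVec hS]
  exact sum_prod_mul_sum fun i => sum_mul_cellScore hS hp W c i

theorem fisherInformation_zero (hS : S.PosDef) (W : Matrix (Fin m) (Fin n) ℂ) :
    fisherInformation S W 0 =
      scoreVariance (cellProb S) S W • (1 : Matrix (Fin 2) (Fin 2) ℝ) := by
  ext c c'
  rw [← sum_prod_mul_score_mul_score hS (cellProb_rotateWord hS) (sum_cellProb hS) W c c',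
    fisherInformation, Matrix.sum_apply]
  simp [likelihood_signVec_zero, Matrix.vecMulVec_apply]

lemma trace_transpose_mul_mul_diagonal {α β : Type*} [Fintype α] [Fintype β] [DecidableEq β]
    (A : Matrix α β ℝ) (g : β → ℝ) :
    (Aᵀ * A * Matrix.diagonal g).trace = ∑ i, ∑ j, g j * A i j ^ 2 := by
  rw [Matrix.trace, Finset.sum_comm]
  refine Finset.sum_congr rfl fun j _ => ?_
  rw [Matrix.diag_apply, Matrix.mul_diagonal, Matrix.mul_apply, Finset.sum_mul]
  refine Finset.sum_congr rfl fun i _ => ?_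
  rw [Matrix.transpose_apply]
  ring

lemma inv_cellMatrix (hS : S.PosDef) :
    (cellMatrix S)⁻¹ = Matrix.diagonal fun j => (cellProb S j)⁻¹ := by
  refine Matrix.inv_eq_left_inv ?_
  rw [cellMatrix, Matrix.diagonal_mul_diagonal]
  simp [(cellProb_pos hS _).ne']

/-- The two traces that normalize the detector, as variances of score components. -/
lemma trace_delta_eq (hS : S.PosDef) {p : (Fin m ⊕ Fin m → Bool) → ℝ}
    (hp : ∀ j, p (rotateWord j) = p j) (W : Matrix (Fin m) (Fin n) ℂ)
    (A : Matrix (Fin n) (Fin m ⊕ Fin m → Bool) ℝ) (c : Fin 2)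
    (hA : ∀ i j, A i j = meanDirection S W c i ⬝ᵥ cellGrad S j) :
    (Aᵀ * A * Matrix.diagonal fun j => p j / cellProb S j ^ 2).trace = scoreVariance p S W := by
  rw [trace_transpose_mul_mul_diagonal, scoreVariance]
  refine Finset.sum_congr rfl fun i _ => ?_
  have h := sum_mul_cellScore_mul_cellScore hS hp W c c i
  rw [if_pos rfl] at h
  rw [← h]
  refine Finset.sum_congr rfl fun j _ => ?_
  rw [hA, cellScore]
  ring

lemma inv_cellMatrix_eq_div_sq (hS : S.PosDef) :
    (cellMatrix S)⁻¹ = Matrix.diagonal fun j => cellProb S j / cellProb S j ^ 2 := by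
  rw [inv_cellMatrix hS]
  congr 1
  funext j
  have := (cellProb_pos hS j).ne'
  field_simp

lemma upsilonSq_eq (hS : S.PosDef) (W : Matrix (Fin m) (Fin n) ℂ) :
    upsilonSq S W = scoreVariance (cellProb S) S W := by
  rw [upsilonSq, inv_cellMatrix_eq_div_sq hS,
    trace_delta_eq hS (cellProb_rotateWord hS) W _ 0 (delta₁_apply W)]

lemma trace_delta₂_inv_cellMatrix (hS : S.PosDef) (W : Matrix (Fin m) (Fin n) ℂ) :
    ((delta₂ S W)ᵀ * delta₂ S W * (cellMatrix S)⁻¹).trace = scoreVariance (cellProb S) S W := by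
  rw [inv_cellMatrix_eq_div_sq hS,
    trace_delta_eq hS (cellProb_rotateWord hS) W _ 1 (delta₂_apply W)]

variable {S' : Matrix (Fin m) (Fin m) ℂ}

lemma upsilonOneSq_eq (hS : S.PosDef) (hS' : S'.PosDef) (W : Matrix (Fin m) (Fin n) ℂ) :
    upsilonOneSq S S' W = scoreVariance (cellProb S') S W := by
  rw [upsilonOneSq, mismatchMatrix,
    trace_delta_eq hS (cellProb_rotateWord hS') W _ 0 (delta₁_apply W)]

lemma trace_delta₂_mismatchMatrix (hS : S.PosDef) (hS' : S'.PosDef)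
    (W : Matrix (Fin m) (Fin n) ℂ) :
    ((delta₂ S W)ᵀ * delta₂ S W * mismatchMatrix S S').trace =
      scoreVariance (cellProb S') S W := by
  rw [mismatchMatrix, trace_delta_eq hS (cellProb_rotateWord hS') W _ 1 (delta₂_apply W)]

lemma columnEnergy_nonneg (W : Matrix (Fin m) (Fin n) ℂ) (i : Fin n) : 0 ≤ columnEnergy W i :=
  Finset.sum_nonneg fun _ _ => sq_nonneg _

lemma sum_sq_signalMean (W : Matrix (Fin m) (Fin n) ℂ) (c : Fin 2) (i : Fin n) :
    ∑ k, signalMean W (Pi.single c 1) i k ^ 2 = columnEnergy W i := by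
  rw [Fintype.sum_sum_type, columnEnergy, ← Finset.sum_add_distrib]
  refine Finset.sum_congr rfl fun k _ => ?_
  rw [Complex.sq_norm, Complex.normSq_apply]
  fin_cases c
  · simp [signalMean_zero_apply]
    ring
  · simp [signalMean_one_apply]
    ring

/-- Cell scores are bounded by the amplitude of their column. -/
lemma exists_sq_cellScore_le (S : Matrix (Fin m) (Fin m) ℂ) :
    ∃ K : ℝ, 0 < K ∧ ∀ (n : ℕ) (W : Matrix (Fin m) (Fin n) ℂ) (c : Fin 2) (i : Fin n)
      (j : Fin m ⊕ Fin m → Bool), cellScore S W c i j ^ 2 ≤ K * columnEnergy W i := by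
  set f : (Fin m ⊕ Fin m → Bool) → Fin m ⊕ Fin m → ℝ := fun j k =>
    (Real.sqrt (stackedCov S k k))⁻¹ * cellGrad S j k / cellProb S j with hf
  refine ⟨∑ j, ∑ k, f j k ^ 2 + 1, by positivity, fun n W c i j => ?_⟩
  have h1 : cellScore S W c i j = ∑ k, f j k * signalMean W (Pi.single c 1) i k := by
    rw [cellScore, meanDirection, dotProduct, Finset.sum_div]
    refine Finset.sum_congr rfl fun k _ => ?_
    rw [invSqrtDiag, Matrix.mulVec_diagonal, hf]
    ring
  have h2 : ∑ k, f j k ^ 2 ≤ ∑ j, ∑ k, f j k ^ 2 :=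
    Finset.single_le_sum (f := fun j => ∑ k, f j k ^ 2) (fun j _ => by positivity)
      (Finset.mem_univ j)
  calc cellScore S W c i j ^ 2
      ≤ (∑ k, f j k ^ 2) * ∑ k, signalMean W (Pi.single c 1) i k ^ 2 := by
        rw [h1]; exact Finset.sum_mul_sq_le_sq_mul_sq _ _ _
    _ ≤ _ := by
        rw [sum_sq_signalMean]
        exact mul_le_mul_of_nonneg_right (by linarith) (columnEnergy_nonneg W i)

/-- The variance of a cell score dominates the energy of its column, because the cell gradients span
the whole space. -/
lemma exists_columnEnergy_le (hS : S.PosDef) {p : (Fin m ⊕ Fin m → Bool) → ℝ}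
    (hp : ∀ j, 0 < p j) :
    ∃ A : ℝ, 0 < A ∧ ∀ (n : ℕ) (W : Matrix (Fin m) (Fin n) ℂ) (i : Fin n),
      columnEnergy W i ≤ A * ∑ j, p j * cellScore S W 0 i j ^ 2 := by
  set C := coherence (stackedCov S) with hCdef
  have hC : C.PosDef := posDef_coherence (posDef_stackedCov hS)
  set κ : Fin m ⊕ Fin m → ℝ := fun k =>
    (Real.sqrt (stackedCov S k k))⁻¹ * ((∫ x, |x k| ∂centeredGaussian C) / C k k) with hκ
  have hκpos : ∀ k, 0 < κ k := fun k =>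
    mul_pos (invSqrtDiag_pos (posDef_stackedCov hS) k)
      (div_pos (integral_abs_coord_pos hC k) hC.diag_pos)
  set N : ℝ := (Fintype.card (Fin m ⊕ Fin m → Bool) : ℝ) with hN
  set M : ℝ := ∑ j, cellProb S j ^ 2 / p j with hM
  have hMj : ∀ j, cellProb S j ^ 2 / p j ≤ M := fun j =>
    Finset.single_le_sum (f := fun j => cellProb S j ^ 2 / p j)
      (fun j _ => div_nonneg (sq_nonneg _) (hp j).le) (Finset.mem_univ j)
  have hM0 : 0 ≤ M := Finset.sum_nonneg fun j _ => div_nonneg (sq_nonneg _) (hp j).le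
  refine ⟨∑ k, (κ k)⁻¹ ^ 2 * (N * M) + 1, by positivity, fun n W i => ?_⟩
  set V := ∑ j, p j * cellScore S W 0 i j ^ 2 with hV
  have hV0 : 0 ≤ V := Finset.sum_nonneg fun j _ => mul_nonneg (hp j).le (sq_nonneg _)
  have hcoord : ∀ k, signalMean W (Pi.single 0 1) i k =
      (κ k)⁻¹ * ∑ j, signVec j k * (cellProb S j * cellScore S W 0 i j) := by
    intro k
    have h := sum_signVec_mul_dotProduct_cellGrad hS (meanDirection S W 0 i) k
    have h2 : ∀ j, cellProb S j * cellScore S W 0 i j = meanDirection S W 0 i ⬝ᵥ cellGrad S j :=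
      fun j => mul_div_cancel₀ _ (cellProb_pos hS j).ne'
    simp only [h2]
    have h3 : meanDirection S W 0 i k =
        (Real.sqrt (stackedCov S k k))⁻¹ * signalMean W (Pi.single 0 1) i k := by
      rw [meanDirection, invSqrtDiag, Matrix.mulVec_diagonal]
    have h4 : ∑ j, signVec j k * (meanDirection S W 0 i ⬝ᵥ cellGrad S j) =
        κ k * signalMean W (Pi.single 0 1) i k := by
      rw [h, h3, hκ]
      ring
    rw [h4, inv_mul_cancel_left₀ (hκpos k).ne']
  have hbound : ∀ k, (∑ j, signVec j k * (cellProb S j * cellScore S W 0 i j)) ^ 2 ≤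
      N * M * V := by
    intro k
    calc _ ≤ N * ∑ j, (signVec j k * (cellProb S j * cellScore S W 0 i j)) ^ 2 := by
          simpa [hN] using sq_sum_le_card_mul_sum_sq (s := Finset.univ)
            (f := fun j => signVec j k * (cellProb S j * cellScore S W 0 i j))
      _ ≤ N * ∑ j, M * (p j * cellScore S W 0 i j ^ 2) := by
          refine mul_le_mul_of_nonneg_left (Finset.sum_le_sum fun j _ => ?_) (by positivity)
          have hpj := (hp j).ne'
          have h5 : (signVec j k * (cellProb S j * cellScore S W 0 i j)) ^ 2 =
              cellProb S j ^ 2 / p j * (p j * cellScore S W 0 i j ^ 2) := by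
            rw [mul_pow, pow_two (signVec j k), signVec_mul_self]
            field_simp
          rw [h5]
          exact mul_le_mul_of_nonneg_right (hMj j) (mul_nonneg (hp j).le (sq_nonneg _))
      _ = N * M * V := by rw [← Finset.mul_sum, mul_assoc]
  calc columnEnergy W i = ∑ k, signalMean W (Pi.single 0 1) i k ^ 2 :=
        (sum_sq_signalMean W 0 i).symm
    _ ≤ ∑ k, (κ k)⁻¹ ^ 2 * (N * M * V) := by
        refine Finset.sum_le_sum fun k _ => ?_
        rw [hcoord, mul_pow]
        exact mul_le_mul_of_nonneg_left (hbound k) (sq_nonneg _)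
    _ = (∑ k, (κ k)⁻¹ ^ 2 * (N * M)) * V := by
        rw [Finset.sum_mul]
        exact Finset.sum_congr rfl fun k _ => by ring
    _ ≤ _ := mul_le_mul_of_nonneg_right (by linarith) hV0

lemma exists_sum_columnEnergy_le (hS : S.PosDef) {p : (Fin m ⊕ Fin m → Bool) → ℝ}
    (hp : ∀ j, 0 < p j) :
    ∃ A : ℝ, 0 < A ∧ ∀ (n : ℕ) (W : Matrix (Fin m) (Fin n) ℂ),
      ∑ i, columnEnergy W i ≤ A * scoreVariance p S W := by
  obtain ⟨A, hA, h⟩ := exists_columnEnergy_le hS hp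
  refine ⟨A, hA, fun n W => ?_⟩
  rw [scoreVariance, Finset.mul_sum]
  exact Finset.sum_le_sum fun i _ => h n W i

lemma exists_scoreVariance_le (S : Matrix (Fin m) (Fin m) ℂ) {p : (Fin m ⊕ Fin m → Bool) → ℝ}
    (hp : ∀ j, 0 < p j) (hp1 : ∑ j, p j = 1) :
    ∃ K : ℝ, 0 < K ∧ ∀ (n : ℕ) (W : Matrix (Fin m) (Fin n) ℂ),
      scoreVariance p S W ≤ K * ∑ i, columnEnergy W i := by
  obtain ⟨K, hK, h⟩ := exists_sq_cellScore_le S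
  refine ⟨K, hK, fun n W => ?_⟩
  rw [scoreVariance, Finset.mul_sum]
  refine Finset.sum_le_sum fun i _ => ?_
  calc ∑ j, p j * cellScore S W 0 i j ^ 2 ≤ ∑ j, p j * (K * columnEnergy W i) :=
        Finset.sum_le_sum fun j _ => mul_le_mul_of_nonneg_left (h n W 0 i j) (hp j).le
    _ = K * columnEnergy W i := by rw [← Finset.sum_mul, hp1, one_mul]

lemma sum_columnEnergy_pos {W : Matrix (Fin m) (Fin n) ℂ} (hW : W ≠ 0) :
    0 < ∑ i, columnEnergy W i := by
  obtain ⟨k, i, hki⟩ : ∃ k i, W k i ≠ 0 := by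
    by_contra! h
    exact hW (Matrix.ext h)
  refine Finset.sum_pos' (fun i _ => columnEnergy_nonneg W i) ⟨i, Finset.mem_univ i, ?_⟩
  exact Finset.sum_pos' (fun k _ => sq_nonneg _) ⟨k, Finset.mem_univ k, by positivity⟩

lemma scoreVariance_pos (hS : S.PosDef) {p : (Fin m ⊕ Fin m → Bool) → ℝ} (hp : ∀ j, 0 < p j)
    {W : Matrix (Fin m) (Fin n) ℂ} (hW : W ≠ 0) : 0 < scoreVariance p S W := by
  obtain ⟨A, hA, h⟩ := exists_sum_columnEnergy_le hS hp
  exact pos_of_mul_pos_right ((sum_columnEnergy_pos hW).trans_le (h n W)) hA.le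

theorem raoStatistic_eq (hS : S.PosDef) {W : Matrix (Fin m) (Fin n) ℂ} (hW : W ≠ 0)
    (Y : Fin n → Fin m ⊕ Fin m → ℝ) :
    raoStatistic S W Y = normalizedScore S W Y 0 ^ 2 + normalizedScore S W Y 1 ^ 2 := by
  have hv := scoreVariance_pos hS (cellProb_pos hS) hW
  have hinv : (fisherInformation S W 0)⁻¹ =
      (scoreVariance (cellProb S) S W)⁻¹ • (1 : Matrix (Fin 2) (Fin 2) ℝ) := by
    refine Matrix.inv_eq_left_inv ?_
    rw [fisherInformation_zero hS, Matrix.smul_mul, Matrix.one_mul, smul_smul,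
      inv_mul_cancel₀ hv.ne', one_smul]
  have hsq : (Real.sqrt (scoreVariance (cellProb S) S W))⁻¹ ^ 2 =
      (scoreVariance (cellProb S) S W)⁻¹ := by
    rw [inv_pow, Real.sq_sqrt hv.le]
  rw [raoStatistic, hinv, Matrix.smul_mulVec, Matrix.one_mulVec, dotProduct_smul, normalizedScore,
    upsilonSq_eq hS]
  simp only [dotProduct, Fin.sum_univ_two, Pi.smul_apply, smul_eq_mul, mul_pow, hsq]
  ring

end Score

/-! ### The law of the one-bit samples -/

section SampleLaw

variable {m n : ℕ} {Ω : Type*} [MeasurableSpace Ω] {P : Measure Ω}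
  {N : Ω → Matrix (Fin m) (Fin n) ℂ} {S : Matrix (Fin m) (Fin m) ℂ}

/-- The sign words of the columns of a data matrix. -/
noncomputable def columnWords (X : Matrix (Fin m) (Fin n) ℂ) : Fin n → Fin m ⊕ Fin m → Bool :=
  fun i => wordOf (stack fun k => X k i)

lemma measurable_stack : Measurable (stack : (Fin m → ℂ) → Fin m ⊕ Fin m → ℝ) := by
  refine measurable_pi_iff.2 fun k => ?_
  rcases k with k | k
  · exact Complex.measurable_re.comp (measurable_pi_apply k)
  · exact Complex.measurable_im.comp (measurable_pi_apply k)

lemma IsCircularGaussianNoise.hasLaw_column (hN : IsCircularGaussianNoise N S P) (i : Fin n) :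
    HasLaw (fun ω => stack fun k => N ω k i) (centeredGaussian (stackedCov S)) P where
  aemeasurable := (WithLp.measurable_ofLp 2 _).comp_aemeasurable (hN.1 i).aemeasurable
  map_eq := by
    rw [centeredGaussian, ← (hN.1 i).map_eq,
      AEMeasurable.map_map_of_aemeasurable (by fun_prop) (hN.1 i).aemeasurable]
    rfl

lemma IsCircularGaussianNoise.aemeasurable_columnWords (hN : IsCircularGaussianNoise N S P) :
    AEMeasurable (fun ω => columnWords (N ω)) P :=
  aemeasurable_pi_iff.2 fun i =>
    measurable_wordOf.comp_aemeasurable (hN.hasLaw_column i).aemeasurable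

/-- Almost surely no coordinate vanishes, so that the one-bit samples are sign vectors. -/
lemma IsCircularGaussianNoise.samples_ae_eq (hS : S.PosDef)
    (hN : IsCircularGaussianNoise N S P) :
    ∀ᵐ ω ∂P, samples (N ω) = fun i => signVec (columnWords (N ω) i) := by
  have h : ∀ᵐ ω ∂P, ∀ i : Fin n, ∀ k, (stack fun k => N ω k i) k ≠ 0 := by
    rw [ae_all_iff]
    intro i
    have := ae_coord_ne_zero (posDef_stackedCov hS)
    rw [← (hN.hasLaw_column i).map_eq] at this
    exact ae_of_ae_map (hN.hasLaw_column i).aemeasurable this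
  filter_upwards [h] with ω hω
  funext i k
  rw [columnWords, ← sign_eq_signVec_wordOf (hω i)]
  rcases k with k | k <;> rfl

lemma centeredGaussian_real_wordOf (hS : S.PosDef) (j : Fin m ⊕ Fin m → Bool) :
    (centeredGaussian (stackedCov S)).real (wordOf ⁻¹' {j}) = cellProb S j := by
  have hR := posDef_stackedCov hS
  have hT : (invSqrtDiag (stackedCov S))ᵀ = invSqrtDiag (stackedCov S) :=
    Matrix.diagonal_transpose _
  have hmap := map_mulVec_centeredGaussian hR.posSemidef (invSqrtDiag (stackedCov S))
  rw [hT] at hmap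
  rw [cellProb_eq hS, coherence, ← hmap,
    map_measureReal_apply (measurable_mulVec _) (measurableSet_signedOrthant _)]
  refine measureReal_congr ?_
  filter_upwards [ae_coord_ne_zero hR] with x hx
  refine propext (((mem_signedOrthant_signVec hx j).symm.trans ?_))
  refine forall_congr' fun k => ?_
  beta_reduce
  rw [invSqrtDiag, Matrix.mulVec_diagonal, mul_left_comm,
    mul_pos_iff_of_pos_left (invSqrtDiag_pos hR k)]

/-- The sign words of the columns are independent, with the cell probabilities as their law. -/
theorem IsCircularGaussianNoise.real_columnWords_eq [IsProbabilityMeasure P] (hS : S.PosDef)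
    (hN : IsCircularGaussianNoise N S P) (J : Fin n → Fin m ⊕ Fin m → Bool) :
    P.real ((fun ω => columnWords (N ω)) ⁻¹' {J}) = ∏ i, cellProb S (J i) := by
  have hind : iIndepFun (fun (i : Fin n) ω => columnWords (N ω) i) P :=
    hN.2.comp (fun _ z => wordOf (stack z)) fun _ => measurable_wordOf.comp measurable_stack
  have hset : (fun ω => columnWords (N ω)) ⁻¹' {J} =
      ⋂ i ∈ (Finset.univ : Finset (Fin n)), (fun ω => columnWords (N ω) i) ⁻¹' {J i} := by
    ext ω
    simp [funext_iff]
  rw [hset, measureReal_def, hind.measure_inter_preimage_eq_mul Finset.univ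
    fun i _ => measurableSet_singleton (J i), ENNReal.toReal_prod]
  refine Finset.prod_congr rfl fun i _ => ?_
  rw [← centeredGaussian_real_wordOf hS, ← (hN.hasLaw_column i).map_eq, measureReal_def,
    Measure.map_apply_of_aemeasurable (hN.hasLaw_column i).aemeasurable
      (measurable_wordOf (measurableSet_singleton _))]
  rfl

lemma IsCircularGaussianNoise.aemeasurable_comp_samples (hS : S.PosDef)
    (hN : IsCircularGaussianNoise N S P) {E : Type*} [MeasurableSpace E]
    (F : (Fin n → Fin m ⊕ Fin m → ℝ) → E) : AEMeasurable (fun ω => F (samples (N ω))) P := by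
  have hF : Measurable fun J : Fin n → Fin m ⊕ Fin m → Bool => F fun i => signVec (J i) :=
    Measurable.of_discrete
  refine (hF.comp_aemeasurable hN.aemeasurable_columnWords).congr ?_
  filter_upwards [hN.samples_ae_eq hS] with ω hω
  simp [hω]

/-- Expectations of functions of the samples are finite sums over sign words. -/
theorem IsCircularGaussianNoise.integral_comp_samples [IsProbabilityMeasure P] (hS : S.PosDef)
    (hN : IsCircularGaussianNoise N S P) {E : Type*} [NormedAddCommGroup E] [NormedSpace ℝ E]
    [CompleteSpace E] (F : (Fin n → Fin m ⊕ Fin m → ℝ) → E) :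
    ∫ ω, F (samples (N ω)) ∂P = ∑ J : Fin n → Fin m ⊕ Fin m → Bool,
      (∏ i, cellProb S (J i)) • F fun i => signVec (J i) := by
  have hJ := hN.aemeasurable_columnWords
  have := Measure.isProbabilityMeasure_map hJ
  set F' : (Fin n → Fin m ⊕ Fin m → Bool) → E := fun J => F fun i => signVec (J i) with hF'
  calc ∫ ω, F (samples (N ω)) ∂P = ∫ ω, F' (columnWords (N ω)) ∂P := by
        refine integral_congr_ae ?_
        filter_upwards [hN.samples_ae_eq hS] with ω hω
        rw [hω]
    _ = ∫ J, F' J ∂(P.map fun ω => columnWords (N ω)) :=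
        (integral_map hJ (StronglyMeasurable.of_discrete).aestronglyMeasurable).symm
    _ = _ := by
        rw [integral_fintype .of_finite]
        refine Finset.sum_congr rfl fun J _ => ?_
        rw [measureReal_def, Measure.map_apply_of_aemeasurable hJ (measurableSet_singleton J),
          ← measureReal_def, hN.real_columnWords_eq hS]

lemma IsCircularGaussianNoise.memLp_comp_samples [IsProbabilityMeasure P] (hS : S.PosDef)
    (hN : IsCircularGaussianNoise N S P) (F : (Fin n → Fin m ⊕ Fin m → ℝ) → ℝ) :
    MemLp (fun ω => F (samples (N ω))) 2 P := by
  refine MemLp.of_bound (hN.aemeasurable_comp_samples hS F).aestronglyMeasurable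
    (∑ J : Fin n → Fin m ⊕ Fin m → Bool, ‖F fun i => signVec (J i)‖) ?_
  filter_upwards [hN.samples_ae_eq hS] with ω hω
  rw [hω]
  exact Finset.single_le_sum (f := fun J : Fin n → Fin m ⊕ Fin m → Bool =>
    ‖F fun i => signVec (J i)‖) (fun J _ => norm_nonneg _) (Finset.mem_univ _)

variable {S' : Matrix (Fin m) (Fin m) ℂ} (W : Matrix (Fin m) (Fin n) ℂ)

theorem IsCircularGaussianNoise.integral_normalizedScore [IsProbabilityMeasure P]
    (hS : S.PosDef) (hS' : S'.PosDef) (hN : IsCircularGaussianNoise N S' P) (c : Fin 2) :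
    ∫ ω, normalizedScore S W (samples (N ω)) c ∂P = 0 := by
  rw [hN.integral_comp_samples hS' fun Y => normalizedScore S W Y c]
  simp only [normalizedScore, Pi.smul_apply, smul_eq_mul, mul_left_comm _ (Real.sqrt _)⁻¹]
  rw [← Finset.mul_sum, sum_prod_mul_score hS (cellProb_rotateWord hS'), mul_zero]

theorem IsCircularGaussianNoise.integral_normalizedScore_mul [IsProbabilityMeasure P]
    (hS : S.PosDef) (hS' : S'.PosDef) (hN : IsCircularGaussianNoise N S' P) (c c' : Fin 2) :
    ∫ ω, normalizedScore S W (samples (N ω)) c * normalizedScore S W (samples (N ω)) c' ∂P =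
      ((upsilonOneSq S S' W / upsilonSq S W) • (1 : Matrix (Fin 2) (Fin 2) ℝ)) c c' := by
  rw [hN.integral_comp_samples hS' fun Y => normalizedScore S W Y c * normalizedScore S W Y c']
  have h0 : 0 ≤ upsilonSq S W := by
    rw [upsilonSq_eq hS]
    exact Finset.sum_nonneg fun i _ => Finset.sum_nonneg fun j _ =>
      mul_nonneg (cellProb_pos hS j).le (sq_nonneg _)
  have hs : (Real.sqrt (upsilonSq S W))⁻¹ * (Real.sqrt (upsilonSq S W))⁻¹ =
      (upsilonSq S W)⁻¹ := by
    rw [← mul_inv, Real.mul_self_sqrt h0]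
  have hterm : ∀ J : Fin n → Fin m ⊕ Fin m → Bool, (∏ i, cellProb S' (J i)) •
      (normalizedScore S W (fun i => signVec (J i)) c *
        normalizedScore S W (fun i => signVec (J i)) c') =
      (upsilonSq S W)⁻¹ * ((∏ i, cellProb S' (J i)) *
        (score S W (fun i => signVec (J i)) 0 c * score S W (fun i => signVec (J i)) 0 c')) := by
    intro J
    simp only [normalizedScore, Pi.smul_apply, smul_eq_mul]
    rw [← hs]
    ring
  simp only [hterm]
  rw [← Finset.mul_sum, sum_prod_mul_score_mul_score hS (cellProb_rotateWord hS')
    (sum_cellProb hS'), upsilonOneSq_eq hS hS']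
  simp only [Matrix.smul_apply, smul_eq_mul]
  ring

/-- The characteristic function of the score factors over the samples. -/
theorem IsCircularGaussianNoise.charFun_score [IsProbabilityMeasure P] (hS : S.PosDef)
    (hS' : S'.PosDef) (hN : IsCircularGaussianNoise N S' P) (r : ℝ)
    (t : EuclideanSpace ℝ (Fin 2)) :
    charFun (P.map fun ω => WithLp.toLp 2 (r • score S W (samples (N ω)) 0)) t =
      ∏ i, ∑ j, (cellProb S' j : ℂ) *
        Complex.exp (((r * (t 0 * cellScore S W 0 i j + t 1 * cellScore S W 1 i j) : ℝ) : ℂ) *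
          Complex.I) := by
  rw [charFun_apply, integral_map
    (hN.aemeasurable_comp_samples hS' fun Y => WithLp.toLp 2 (r • score S W Y 0)) (by fun_prop),
    hN.integral_comp_samples hS' fun Y =>
      Complex.exp (inner ℝ (WithLp.toLp 2 (r • score S W Y 0)) t * Complex.I)]
  rw [← sum_prod_eq_prod_sum fun i j => (cellProb S' j : ℂ) *
        Complex.exp (((r * (t 0 * cellScore S W 0 i j + t 1 * cellScore S W 1 i j) : ℝ) : ℂ) *
          Complex.I)]
  refine Finset.sum_congr rfl fun J _ => ?_
  rw [Finset.prod_mul_distrib, ← Complex.exp_sum, ← Finset.sum_mul, ← Complex.ofReal_sum,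
    Complex.real_smul, Complex.ofReal_prod]
  congr 4
  rw [PiLp.inner_apply, Fin.sum_univ_two]
  simp only [Pi.smul_apply, score_signVec hS, RCLike.inner_apply, conj_trivial, smul_eq_mul]
  rw [← Finset.mul_sum, Finset.sum_add_distrib, ← Finset.mul_sum, ← Finset.mul_sum]
  ring

end SampleLaw

/-! ### A quantitative central limit theorem for bounded triangular arrays -/

section Lindeberg

lemma norm_prod_sub_prod_le_sum {ι : Type*} (s : Finset ι) {f g : ι → ℂ}
    (hf : ∀ i ∈ s, ‖f i‖ ≤ 1) (hg : ∀ i ∈ s, ‖g i‖ ≤ 1) :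
    ‖∏ i ∈ s, f i - ∏ i ∈ s, g i‖ ≤ ∑ i ∈ s, ‖f i - g i‖ := by
  classical
  induction s using Finset.induction_on with
  | empty => simp
  | insert a s ha ih =>
    rw [Finset.prod_insert ha, Finset.prod_insert ha, Finset.sum_insert ha]
    have ih' := ih (fun i hi => hf i (Finset.mem_insert_of_mem hi))
      fun i hi => hg i (Finset.mem_insert_of_mem hi)
    have hprod : ‖∏ i ∈ s, f i‖ ≤ 1 := by
      rw [norm_prod]
      exact Finset.prod_le_one (fun _ _ => norm_nonneg _)
        fun i hi => hf i (Finset.mem_insert_of_mem hi)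
    have hga := hg a (Finset.mem_insert_self a s)
    calc ‖f a * ∏ i ∈ s, f i - g a * ∏ i ∈ s, g i‖
        = ‖(f a - g a) * ∏ i ∈ s, f i + g a * (∏ i ∈ s, f i - ∏ i ∈ s, g i)‖ := by ring_nf
      _ ≤ ‖f a - g a‖ * ‖∏ i ∈ s, f i‖ + ‖g a‖ * ‖∏ i ∈ s, f i - ∏ i ∈ s, g i‖ := by
          refine (norm_add_le _ _).trans ?_
          rw [norm_mul, norm_mul]
      _ ≤ ‖f a - g a‖ * 1 + 1 * ∑ i ∈ s, ‖f i - g i‖ := by gcongr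
      _ = _ := by ring

lemma norm_exp_mul_I_sub_taylor_le {x : ℝ} (hx : |x| ≤ 1) :
    ‖Complex.exp (x * Complex.I) - (1 + x * Complex.I - (x : ℂ) ^ 2 / 2)‖ ≤ |x| ^ 3 := by
  have hn : ‖(x : ℂ) * Complex.I‖ = |x| := by simp
  have h := Complex.exp_bound (x := (x : ℂ) * Complex.I) (by rw [hn]; exact hx)
    (n := 3) (by norm_num)
  rw [hn] at h
  have hsum : ∑ k ∈ Finset.range 3, ((x : ℂ) * Complex.I) ^ k / (k.factorial : ℂ) =
      1 + x * Complex.I - (x : ℂ) ^ 2 / 2 := by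
    simp [Finset.sum_range_succ, mul_pow]
    ring
  rw [hsum] at h
  refine h.trans (mul_le_of_le_one_right (by positivity) ?_)
  norm_num [Nat.factorial]

/-- Lindeberg's comparison for a sum of independent, centered, finitely valued random variables
bounded by `δ`: its characteristic function at `1` is close to that of the normal law with the same
variance. -/
theorem norm_prod_sum_mul_exp_sub_le {α : Type*} [Fintype α] {n : ℕ} {p : α → ℝ}
    (hp : ∀ j, 0 ≤ p j) (hp1 : ∑ j, p j = 1) {x : Fin n → α → ℝ}
    (hx : ∀ i, ∑ j, p j * x i j = 0) {δ : ℝ} (hδ0 : 0 ≤ δ) (hδ1 : δ ≤ 1)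
    (hδ : ∀ i j, |x i j| ≤ δ) :
    ‖∏ i, ∑ j, (p j : ℂ) * Complex.exp ((x i j : ℝ) * Complex.I) -
      Complex.exp ((-(∑ i, ∑ j, p j * x i j ^ 2) / 2 : ℝ) : ℂ)‖ ≤
      2 * δ * ∑ i, ∑ j, p j * x i j ^ 2 := by
  set s : Fin n → ℝ := fun i => ∑ j, p j * x i j ^ 2 with hs
  have hs0 : ∀ i, 0 ≤ s i := fun i => Finset.sum_nonneg fun j _ => mul_nonneg (hp j) (sq_nonneg _)
  have hsδ : ∀ i, s i ≤ δ := fun i => by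
    calc s i ≤ ∑ j, p j * δ := by
          refine Finset.sum_le_sum fun j _ => mul_le_mul_of_nonneg_left ?_ (hp j)
          calc x i j ^ 2 = |x i j| * |x i j| := by rw [← sq_abs, pow_two]
            _ ≤ δ * 1 := mul_le_mul (hδ i j) ((hδ i j).trans hδ1) (abs_nonneg _) hδ0
            _ = δ := mul_one δ
      _ = δ := by rw [← Finset.sum_mul, hp1, one_mul]
  have hexp : Complex.exp ((-(∑ i, s i) / 2 : ℝ) : ℂ) =
      ∏ i, Complex.exp ((-(s i) / 2 : ℝ) : ℂ) := by
    rw [← Complex.exp_sum, ← Complex.ofReal_sum, ← Finset.sum_div, Finset.sum_neg_distrib]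
  have hg : ∀ i ∈ Finset.univ, ‖Complex.exp ((-(s i) / 2 : ℝ) : ℂ)‖ ≤ 1 := fun i _ => by
    rw [Complex.norm_exp_ofReal]
    exact Real.exp_le_one_iff.2 (by linarith [hs0 i])
  have hf : ∀ i ∈ Finset.univ,
      ‖∑ j, (p j : ℂ) * Complex.exp ((x i j : ℝ) * Complex.I)‖ ≤ 1 := fun i _ => by
    refine (norm_sum_le _ _).trans_eq ?_
    simp only [norm_mul, Complex.norm_exp_ofReal_mul_I, mul_one, Complex.norm_real,
      Real.norm_of_nonneg (hp _), hp1]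
  rw [hexp, Finset.mul_sum]
  refine (norm_prod_sub_prod_le_sum Finset.univ hf hg).trans (Finset.sum_le_sum fun i _ => ?_)
  have hmean : ∑ j, (p j : ℂ) * (1 + (x i j : ℝ) * Complex.I - ((x i j : ℝ) : ℂ) ^ 2 / 2) =
      1 - (s i : ℂ) / 2 := by
    have h1 : ∑ j, (p j : ℂ) = 1 := by rw [← Complex.ofReal_sum, hp1, Complex.ofReal_one]
    have h2 : ∑ j, (p j : ℂ) * (x i j : ℂ) = 0 := by
      have := congrArg (fun y : ℝ => (y : ℂ)) (hx i)
      simpa using this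
    have h3 : ∑ j, (p j : ℂ) * (x i j : ℂ) ^ 2 = (s i : ℂ) := by
      simp [hs]
    have hterm : ∀ j, (p j : ℂ) * (1 + (x i j : ℝ) * Complex.I - ((x i j : ℝ) : ℂ) ^ 2 / 2) =
        p j + (p j : ℂ) * x i j * Complex.I - (p j : ℂ) * (x i j : ℂ) ^ 2 / 2 := fun j => by ring
    simp only [hterm]
    rw [Finset.sum_sub_distrib, Finset.sum_add_distrib, ← Finset.sum_mul, ← Finset.sum_div, h1, h2,
      h3]
    ring
  have hA : ‖∑ j, (p j : ℂ) * Complex.exp ((x i j : ℝ) * Complex.I) - (1 - (s i : ℂ) / 2)‖ ≤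
      δ * s i := by
    rw [← hmean, ← Finset.sum_sub_distrib, hs, Finset.mul_sum]
    refine (norm_sum_le _ _).trans (Finset.sum_le_sum fun j _ => ?_)
    rw [← mul_sub, norm_mul, Complex.norm_real, Real.norm_of_nonneg (hp j)]
    calc p j * _ ≤ p j * |x i j| ^ 3 := mul_le_mul_of_nonneg_left
          (norm_exp_mul_I_sub_taylor_le ((hδ i j).trans hδ1)) (hp j)
      _ = |x i j| * (p j * x i j ^ 2) := by rw [pow_succ, sq_abs]; ring
      _ ≤ δ * (p j * x i j ^ 2) :=
          mul_le_mul_of_nonneg_right (hδ i j) (mul_nonneg (hp j) (sq_nonneg _))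
  have hB : ‖(1 - (s i : ℂ) / 2) - Complex.exp ((-(s i) / 2 : ℝ) : ℂ)‖ ≤ δ * s i := by
    have hreal : (1 - (s i : ℂ) / 2) - Complex.exp ((-(s i) / 2 : ℝ) : ℂ) =
        ((-(Real.exp (-(s i) / 2) - 1 - -(s i) / 2) : ℝ) : ℂ) := by
      push_cast
      ring
    rw [hreal, Complex.norm_real, norm_neg, Real.norm_eq_abs]
    have h := Real.abs_exp_sub_one_sub_id_le (x := -(s i) / 2)
      (by rw [abs_le]; constructor <;> linarith [hs0 i, hsδ i])
    nlinarith [hs0 i, hsδ i]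
  calc _ ≤ _ := norm_sub_le_norm_sub_add_norm_sub _ (1 - (s i : ℂ) / 2) _
    _ ≤ δ * s i + δ * s i := add_le_add hA hB
    _ = 2 * δ * s i := by ring

end Lindeberg

/-! ### The tail of the chi-square law with two degrees of freedom -/

section ChiSquared

lemma integral_Ioi_mul_exp_neg_sq_div_two {a : ℝ} (ha : 0 ≤ a) :
    ∫ r in Set.Ioi a, r * Real.exp (-(1 / 2) * r ^ 2) = Real.exp (-(1 / 2) * a ^ 2) := by
  have hderiv : ∀ r ∈ Set.Ici a, HasDerivAt (fun r : ℝ => -Real.exp (-(1 / 2) * r ^ 2))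
      (r * Real.exp (-(1 / 2) * r ^ 2)) r := by
    intro r _
    have h := (((hasDerivAt_pow 2 r).const_mul (-(1 / 2))).exp).neg
    refine h.congr_deriv ?_
    simp
    ring
  have hlim : Tendsto (fun r : ℝ => -Real.exp (-(1 / 2) * r ^ 2)) atTop (𝓝 0) := by
    rw [← neg_zero]
    refine (Real.tendsto_exp_atBot.comp ?_).neg
    exact (tendsto_pow_atTop two_ne_zero).const_mul_atTop_of_neg (by norm_num)
  rw [integral_Ioi_of_hasDerivAt_of_nonneg' hderiv
    (fun r hr => mul_nonneg (ha.trans (le_of_lt hr)) (Real.exp_pos _).le) hlim]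
  ring

/-- In polar coordinates the chi-square law with two degrees of freedom is exponential. -/
theorem chiSquared_two_real_Ioi {g : ℝ} (hg : 0 ≤ g) :
    (chiSquared 2).real (Set.Ioi g) = Real.exp (-g / 2) := by
  set A : Set (Fin 2 → ℝ) := {x | g < ∑ i, x i ^ 2} with hA
  set B : Set (ℝ × ℝ) := {p | g < p.1 ^ 2 + p.2 ^ 2} with hB
  have hAm : MeasurableSet A := measurableSet_lt measurable_const (by fun_prop)
  have hBm : MeasurableSet B := measurableSet_lt measurable_const (by fun_prop)
  have h1 : (chiSquared 2).real (Set.Ioi g) =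
      (Measure.pi fun _ : Fin 2 => gaussianReal 0 1).real A := by
    rw [chiSquared, map_measureReal_apply (by fun_prop) measurableSet_Ioi, ← map_pi_eq_stdGaussian,
      map_measureReal_apply (by fun_prop)
        (measurableSet_Ioi.preimage (by fun_prop))]
    rfl
  set d : ℝ × ℝ → ℝ := fun p => (2 * Real.pi)⁻¹ * Real.exp (-(1 / 2) * (p.1 ^ 2 + p.2 ^ 2)) with hd
  have hdens : ∀ x : Fin 2 → ℝ, ∏ k, gaussianPDFReal 0 1 (x k) = d (x 0, x 1) := by
    intro x
    rw [prod_gaussianPDFReal, hd]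
    simp [dotProduct, Fin.sum_univ_two, pow_two]
  have h2 : (Measure.pi fun _ : Fin 2 => gaussianReal 0 1).real A =
      ∫ x in A, d (x 0, x 1) := by
    have hone : (Measure.pi fun _ : Fin 2 => gaussianReal 0 1).real A =
        ∫ x in A, (1 : ℝ) ∂(Measure.pi fun _ : Fin 2 => gaussianReal 0 1) := by simp
    have hpm : Measurable fun x : Fin 2 → ℝ => ∏ k, gaussianPDFReal 0 1 (x k) :=
      Finset.measurable_prod _ fun k _ =>
        (measurable_gaussianPDFReal 0 1).comp (measurable_pi_apply k)
    rw [hone, pi_gaussianReal_eq_withDensity,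
      setIntegral_withDensity_eq_setIntegral_toReal_smul hpm.ennreal_ofReal (by simp) _ hAm]
    refine integral_congr_ae (Filter.Eventually.of_forall fun x => ?_)
    have hnn : 0 ≤ ∏ k, gaussianPDFReal 0 1 (x k) :=
      Finset.prod_nonneg fun k _ => gaussianPDFReal_nonneg 0 1 (x k)
    simp only [ENNReal.toReal_ofReal hnn, smul_eq_mul, mul_one]
    exact hdens x
  have h3 : ∫ x in A, d (x 0, x 1) = ∫ p in B, d p := by
    have hmp := volume_preserving_finTwoArrow ℝ
    have := hmp.setIntegral_preimage_emb (MeasurableEquiv.measurableEmbedding _) d B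
    rw [← this]
    congr 2
    ext x
    simp [hA, hB, Fin.sum_univ_two]
  have h4 : ∫ p in B, d p = ∫ p in polarCoord.target,
      (Set.Ioi (Real.sqrt g)).indicator (fun r => r * Real.exp (-(1 / 2) * r ^ 2)) p.1 *
        (2 * Real.pi)⁻¹ := by
    rw [← integral_indicator hBm, ← integral_comp_polarCoord_symm]
    refine setIntegral_congr_fun polarCoord.open_target.measurableSet fun p hp => ?_
    have hp0 : 0 < p.1 := hp.1
    have hsq : (polarCoord.symm p).1 ^ 2 + (polarCoord.symm p).2 ^ 2 = p.1 ^ 2 := by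
      simp only [polarCoord_symm_apply]
      linear_combination p.1 ^ 2 * Real.sin_sq_add_cos_sq p.2
    by_cases h : g < p.1 ^ 2
    · have hmem : polarCoord.symm p ∈ B := by
        change g < _
        rwa [hsq]
      have hmem' : p.1 ∈ Set.Ioi (Real.sqrt g) := (Real.sqrt_lt' hp0).2 h
      simp only [Set.indicator_of_mem hmem, Set.indicator_of_mem hmem', hd, hsq, smul_eq_mul]
      ring
    · have hmem : polarCoord.symm p ∉ B := by
        change ¬ g < _
        rwa [hsq]
      have hmem' : p.1 ∉ Set.Ioi (Real.sqrt g) := fun h' => h ((Real.sqrt_lt' hp0).1 h')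
      simp only [Set.indicator_of_notMem hmem, Set.indicator_of_notMem hmem', smul_zero, zero_mul]
  rw [h1, h2, h3, h4, polarCoord_target, Measure.volume_eq_prod,
    setIntegral_prod_mul _ (fun _ => (2 * Real.pi)⁻¹), setIntegral_indicator measurableSet_Ioi]
  have hinter : Set.Ioi (0 : ℝ) ∩ Set.Ioi (Real.sqrt g) = Set.Ioi (Real.sqrt g) :=
    Set.inter_eq_self_of_subset_right (Set.Ioi_subset_Ioi (Real.sqrt_nonneg g))
  rw [hinter, integral_Ioi_mul_exp_neg_sq_div_two (Real.sqrt_nonneg g), Real.sq_sqrt hg,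
    setIntegral_const, Real.volume_real_Ioo_of_le (by linarith [Real.pi_pos])]
  have hpi := Real.pi_ne_zero
  rw [smul_eq_mul, show (Real.pi - -Real.pi) * (2 * Real.pi)⁻¹ = 1 by field_simp; norm_num,
    mul_one]
  congr 1
  ring

/-- The chi-square law with two degrees of freedom has no atoms, since its tail is continuous. -/
lemma chiSquared_two_singleton {g : ℝ} (hg : 0 ≤ g) : chiSquared 2 {g} = 0 := by
  have hdisj : Disjoint {g} (Set.Ioi g) := by simp
  have hunion := measureReal_union (μ := chiSquared 2) hdisj measurableSet_Ioi
  rw [chiSquared_two_real_Ioi hg] at hunion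
  have hzero : (chiSquared 2).real {g} ≤ 0 := by
    rcases hg.eq_or_lt with rfl | hg
    · have : (chiSquared 2).real ({0} ∪ Set.Ioi 0) ≤ 1 := measureReal_le_one
      rw [hunion] at this
      simpa using this
    · have hle : ∀ᶠ h in 𝓝[<] g,
          (chiSquared 2).real {g} ≤ Real.exp (-h / 2) - Real.exp (-g / 2) := by
        filter_upwards [Ioo_mem_nhdsLT hg] with h hh
        have hsub : {g} ∪ Set.Ioi g ⊆ Set.Ioi h := by
          rintro x (rfl | hx)
          · exact hh.2
          · exact hh.2.trans hx
        have := measureReal_mono (μ := chiSquared 2) hsub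
        rw [hunion, chiSquared_two_real_Ioi hh.1.le] at this
        linarith
      have hcont : Continuous fun h : ℝ => Real.exp (-h / 2) - Real.exp (-g / 2) := by fun_prop
      have hlim := (hcont.tendsto g).mono_left (nhdsWithin_le_nhds (s := Set.Iio g))
      rw [sub_self] at hlim
      exact ge_of_tendsto hlim hle
  exact (measureReal_eq_zero_iff).1 (le_antisymm hzero measureReal_nonneg)

end ChiSquared

/-! ### Weak convergence -/

section WeakConvergence

/-- Pólya's theorem in the case of an exponential limit: pointwise convergence of tail functions is
uniform. -/
theorem eventually_abs_sub_exp_lt_of_antitone {F : ℕ → ℝ → ℝ} (hF : ∀ n, Antitone (F n))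
    (h0 : ∀ n g, 0 ≤ F n g)
    (hlim : ∀ g, 0 ≤ g → Tendsto (fun n => F n g) atTop (𝓝 (Real.exp (-g / 2))))
    {ε : ℝ} (hε : 0 < ε) :
    ∀ᶠ n in atTop, ∀ g, 0 ≤ g → |F n g - Real.exp (-g / 2)| < ε := by
  obtain ⟨K, hK⟩ := exists_nat_gt (2 / ε)
  have hK0 : (0 : ℝ) < K := (by positivity : (0 : ℝ) < 2 / ε).trans hK
  have hKε : 1 / (K : ℝ) < ε / 2 := by
    rw [div_lt_div_iff₀ hK0 two_pos]
    rw [div_lt_iff₀ hε] at hK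
    linarith
  -- the quantiles at which the limit tail equals `1 - k / K`
  set q : ℕ → ℝ := fun k => -2 * Real.log (1 - k / K) with hq
  have hfrac : ∀ k : ℕ, k < K → 0 < 1 - (k : ℝ) / K := fun k hk => by
    have : (k : ℝ) / K < 1 := by
      rw [div_lt_one hK0]
      exact_mod_cast hk
    linarith
  have hqexp : ∀ k : ℕ, k < K → Real.exp (-q k / 2) = 1 - k / K := fun k hk => by
    have : -q k / 2 = Real.log (1 - k / K) := by rw [hq]; ring
    rw [this, Real.exp_log (hfrac k hk)]
  have hq0 : ∀ k : ℕ, k < K → 0 ≤ q k := fun k hk => by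
    have : Real.log (1 - k / K) ≤ 0 :=
      Real.log_nonpos (hfrac k hk).le (by have : (0 : ℝ) ≤ k / K := by positivity
                                          linarith)
    rw [hq]
    simp only
    linarith
  have hall : ∀ᶠ n in atTop, ∀ k ∈ Finset.range K,
      |F n (q k) - Real.exp (-q k / 2)| < ε / 2 := by
    rw [Finset.eventually_all]
    intro k hk
    have h := (hlim (q k) (hq0 k (Finset.mem_range.1 hk)))
    rw [Metric.tendsto_atTop] at h
    obtain ⟨n₀, hn₀⟩ := h (ε / 2) (half_pos hε)
    filter_upwards [eventually_ge_atTop n₀] with n hn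
    exact hn₀ n hn
  filter_upwards [hall] with n hn g hg
  set u := Real.exp (-g / 2) with hu
  have hu0 : 0 < u := Real.exp_pos _
  have hu1 : u ≤ 1 := Real.exp_le_one_iff.2 (by linarith)
  set k := ⌊K * (1 - u)⌋₊ with hk
  have hnn : 0 ≤ K * (1 - u) := mul_nonneg hK0.le (by linarith)
  have hk1 : (k : ℝ) ≤ K * (1 - u) := Nat.floor_le hnn
  have hk2 : K * (1 - u) < k + 1 := Nat.lt_floor_add_one _
  have hkK : k < K := by
    have : (k : ℝ) < K := by nlinarith
    exact_mod_cast this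
  have hcmp : ∀ l : ℕ, l < K →
      ((1 - (l : ℝ) / K ≥ u → q l ≤ g) ∧ (1 - (l : ℝ) / K ≤ u → g ≤ q l)) := by
    intro l hl
    constructor
    · intro h
      rw [← hqexp l hl, hu, ge_iff_le, Real.exp_le_exp] at h
      linarith
    · intro h
      rw [← hqexp l hl, hu, Real.exp_le_exp] at h
      linarith
  have hku : (k : ℝ) / K ≤ 1 - u := by rw [div_le_iff₀ hK0]; linarith
  have hku2 : 1 - u < ((k + 1 : ℕ) : ℝ) / K := by
    rw [lt_div_iff₀ hK0]; push_cast; linarith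
  have hsplit : ((k + 1 : ℕ) : ℝ) / K = k / K + 1 / K := by push_cast; ring
  have hup := hF n ((hcmp k hkK).1 (by linarith))
  have hnk := abs_lt.1 (hn k (Finset.mem_range.2 hkK))
  rw [hqexp k hkK] at hnk
  rw [abs_lt]
  refine ⟨?_, by linarith⟩
  by_cases hk' : k + 1 < K
  · have hlow := hF n ((hcmp (k + 1) hk').2 (by linarith))
    have hnk' := abs_lt.1 (hn (k + 1) (Finset.mem_range.2 hk'))
    rw [hqexp (k + 1) hk'] at hnk'
    linarith
  · have hKk : K = k + 1 := by omega
    have : ((k + 1 : ℕ) : ℝ) / K = 1 := by rw [← hKk]; exact div_self hK0.ne'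
    linarith [h0 n g]

lemma tendstoInDistribution_congr_eventually {Ω : ℕ → Type*} {Ω' Ω'' E : Type*}
    [∀ n, MeasurableSpace (Ω n)] [MeasurableSpace Ω'] [MeasurableSpace Ω''] [MeasurableSpace E]
    [TopologicalSpace E] [OpensMeasurableSpace E] {P : ∀ n, Measure (Ω n)}
    [∀ n, IsProbabilityMeasure (P n)] {P' : Measure Ω'} [IsProbabilityMeasure P']
    {P'' : Measure Ω''} [IsProbabilityMeasure P''] {X Y : ∀ n, Ω n → E} {Z : Ω' → E} {Z' : Ω'' → E}
    (h : TendstoInDistribution X atTop Z P P') (hY : ∀ n, AEMeasurable (Y n) (P n))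
    (hXY : ∀ᶠ n in atTop, X n = Y n) (hZ' : AEMeasurable Z' P'') (hZ : P'.map Z = P''.map Z') :
    TendstoInDistribution Y atTop Z' P P'' where
  forall_aemeasurable := hY
  aemeasurable_limit := hZ'
  tendsto := by
    have hlim := h.tendsto
    have heq : (⟨P'.map Z, Measure.isProbabilityMeasure_map h.aemeasurable_limit⟩ :
        ProbabilityMeasure E) = ⟨P''.map Z', Measure.isProbabilityMeasure_map hZ'⟩ :=
      Subtype.ext hZ
    rw [← heq]
    refine hlim.congr' ?_
    filter_upwards [hXY] with n hn
    exact Subtype.ext (congrArg (fun V => (P n).map V) hn)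

lemma charFun_multivariateGaussian_smul_one {ρ : ℝ} (hρ : 0 ≤ ρ)
    (t : EuclideanSpace ℝ (Fin 2)) :
    charFun (multivariateGaussian 0 (ρ • (1 : Matrix (Fin 2) (Fin 2) ℝ))) t =
      Complex.exp ((-(ρ * ‖t‖ ^ 2) / 2 : ℝ) : ℂ) := by
  have hpsd : (ρ • (1 : Matrix (Fin 2) (Fin 2) ℝ)).PosSemidef := Matrix.PosSemidef.one.smul hρ
  rw [charFun_multivariateGaussian hpsd]
  congr 1
  rw [Matrix.smul_mulVec, Matrix.one_mulVec, dotProduct_smul, EuclideanSpace.real_norm_sq_eq]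
  simp [dotProduct, Fin.sum_univ_two, pow_two]
  ring

/-- Laws whose characteristic functions approach those of the isotropic normal laws with bounded
variances `ρ n` are weakly close to them: along a subsequence on which `ρ` converges both sides
have the same normal limit. -/
theorem tendsto_integral_sub_multivariateGaussian
    {μ : ℕ → Measure (EuclideanSpace ℝ (Fin 2))} [∀ n, IsProbabilityMeasure (μ n)] {ρ : ℕ → ℝ}
    {M : ℝ} (hρ : ∀ᶠ n in atTop, ρ n ∈ Set.Icc 0 M)
    (hchar : ∀ t, Tendsto (fun n => charFun (μ n) t -
      Complex.exp ((-(ρ n * ‖t‖ ^ 2) / 2 : ℝ) : ℂ)) atTop (𝓝 0))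
    (f : EuclideanSpace ℝ (Fin 2) →ᵇ ℝ) :
    Tendsto (fun n => ∫ x, f x ∂μ n -
      ∫ x, f x ∂multivariateGaussian 0 (ρ n • (1 : Matrix (Fin 2) (Fin 2) ℝ)))
      atTop (𝓝 0) := by
  refine tendsto_of_subseq_tendsto fun ns hns => ?_
  obtain ⟨ρ₀, hρ₀, φ, hφ, hlim⟩ := isCompact_Icc.tendsto_subseq' (hns.eventually hρ).frequently
  have hψ : Tendsto (fun k => ns (φ k)) atTop atTop := hns.comp hφ.tendsto_atTop
  refine ⟨φ, ?_⟩
  have hexp : ∀ t : EuclideanSpace ℝ (Fin 2),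
      Tendsto (fun k => Complex.exp ((-(ρ (ns (φ k)) * ‖t‖ ^ 2) / 2 : ℝ) : ℂ)) atTop
        (𝓝 (Complex.exp ((-(ρ₀ * ‖t‖ ^ 2) / 2 : ℝ) : ℂ))) := by
    intro t
    have hc : Continuous fun r : ℝ => Complex.exp ((-(r * ‖t‖ ^ 2) / 2 : ℝ) : ℂ) := by fun_prop
    exact (hc.tendsto ρ₀).comp hlim
  let ν : ProbabilityMeasure (EuclideanSpace ℝ (Fin 2)) :=
    ⟨multivariateGaussian 0 (ρ₀ • (1 : Matrix (Fin 2) (Fin 2) ℝ)), inferInstance⟩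
  have h1 : Tendsto (β := ProbabilityMeasure (EuclideanSpace ℝ (Fin 2)))
      (fun k => (⟨μ (ns (φ k)), inferInstance⟩ :
      ProbabilityMeasure (EuclideanSpace ℝ (Fin 2)))) atTop (𝓝 ν) := by
    refine ProbabilityMeasure.tendsto_iff_tendsto_charFun.2 fun t => ?_
    have := ((hchar t).comp hψ).add (hexp t)
    simp only [Function.comp_def, sub_add_cancel, zero_add] at this
    rwa [← charFun_multivariateGaussian_smul_one hρ₀.1] at this
  have h2 : Tendsto (β := ProbabilityMeasure (EuclideanSpace ℝ (Fin 2)))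
      (fun k => (⟨multivariateGaussian 0 (ρ (ns (φ k)) •
        (1 : Matrix (Fin 2) (Fin 2) ℝ)), inferInstance⟩ :
      ProbabilityMeasure (EuclideanSpace ℝ (Fin 2)))) atTop (𝓝 ν) := by
    refine ProbabilityMeasure.tendsto_iff_tendsto_charFun.2 fun t => ?_
    have := hexp t
    rw [← charFun_multivariateGaussian_smul_one hρ₀.1] at this
    refine this.congr' ?_
    filter_upwards [hψ.eventually hρ] with k hk
    exact (charFun_multivariateGaussian_smul_one hk.1 t).symm
  have h := ((ProbabilityMeasure.tendsto_iff_forall_integral_tendsto.1 h1) f).sub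
    ((ProbabilityMeasure.tendsto_iff_forall_integral_tendsto.1 h2) f)
  rw [sub_self] at h
  exact h

end WeakConvergence

/-! ### Asymptotic normality of the score -/

section Asymptotics

variable {m : ℕ} {S S' : Matrix (Fin m) (Fin m) ℂ} {W : (n : ℕ) → Matrix (Fin m) (Fin n) ℂ}
  {Ω : ℕ → Type*} [∀ n, MeasurableSpace (Ω n)] {P : (n : ℕ) → Measure (Ω n)}
  [∀ n, IsProbabilityMeasure (P n)] {N : (n : ℕ) → Ω n → Matrix (Fin m) (Fin n) ℂ}

/-- The characteristic function of the rescaled score approaches that of the normal law with the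
same covariance matrix, for any scaling that keeps the total energy bounded. -/
theorem tendsto_charFun_score_sub (hS : S.PosDef) (hS' : S'.PosDef)
    (hneg : ∀ ε : ℝ, 0 < ε → ∀ᶠ n in atTop, ∀ i : Fin n,
      columnEnergy (W n) i ≤ ε * ∑ l, columnEnergy (W n) l)
    (hN : ∀ n, IsCircularGaussianNoise (N n) S' (P n)) {r : ℕ → ℝ} {B : ℝ}
    (hr : ∀ᶠ n in atTop, r n ^ 2 * ∑ i, columnEnergy (W n) i ≤ B)
    (t : EuclideanSpace ℝ (Fin 2)) :
    Tendsto (fun n => charFun ((P n).map fun ω =>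
        WithLp.toLp 2 (r n • score S (W n) (samples (N n ω)) 0)) t -
      Complex.exp ((-(r n ^ 2 * upsilonOneSq S S' (W n) * ‖t‖ ^ 2) / 2 : ℝ) : ℂ))
      atTop (𝓝 0) := by
  obtain ⟨K, hK, hcell⟩ := exists_sq_cellScore_le S
  obtain ⟨K', hK', hvar⟩ := exists_scoreVariance_le S (cellProb_pos hS') (sum_cellProb hS')
  have ht : ‖t‖ ^ 2 = t 0 ^ 2 + t 1 ^ 2 := by
    rw [EuclideanSpace.real_norm_sq_eq, Fin.sum_univ_two]
  rw [Metric.tendsto_atTop']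
  intro η hη
  set D : ℝ := 2 * (K' * |B| * ‖t‖ ^ 2) + 1 with hD
  have hDpos : 0 < D := by positivity
  set δ : ℝ := min 1 (η / (2 * D)) with hδ
  have hδ0 : 0 < δ := lt_min one_pos (by positivity)
  set ε : ℝ := δ ^ 2 / (2 * ‖t‖ ^ 2 * K * |B| + 1) with hε
  have hε0 : 0 < ε := by positivity
  have hgoal : ∀ᶠ n in atTop, dist (charFun ((P n).map fun ω =>
        WithLp.toLp 2 (r n • score S (W n) (samples (N n ω)) 0)) t -
      Complex.exp ((-(r n ^ 2 * upsilonOneSq S S' (W n) * ‖t‖ ^ 2) / 2 : ℝ) : ℂ)) 0 < η := by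
    filter_upwards [hneg ε hε0, hr] with n hn hrn
    set x : Fin n → (Fin m ⊕ Fin m → Bool) → ℝ := fun i j =>
      r n * (t 0 * cellScore S (W n) 0 i j + t 1 * cellScore S (W n) 1 i j) with hx
    set E := ∑ i, columnEnergy (W n) i with hE
    have hrB : r n ^ 2 * E ≤ |B| := hrn.trans (le_abs_self B)
    have hbound : ∀ i j, |x i j| ≤ δ := by
      intro i j
      refine abs_le_of_sq_le_sq ?_ hδ0.le
      have h0 := hcell n (W n) 0 i j
      have h1 := hcell n (W n) 1 i j
      have hcs : (t 0 * cellScore S (W n) 0 i j + t 1 * cellScore S (W n) 1 i j) ^ 2 ≤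
          ‖t‖ ^ 2 * (2 * (K * columnEnergy (W n) i)) := by
        calc _ ≤ (t 0 ^ 2 + t 1 ^ 2) *
              (cellScore S (W n) 0 i j ^ 2 + cellScore S (W n) 1 i j ^ 2) := by
              nlinarith [sq_nonneg (t 0 * cellScore S (W n) 1 i j -
                t 1 * cellScore S (W n) 0 i j)]
          _ ≤ _ := by
              rw [ht]
              exact mul_le_mul_of_nonneg_left (by linarith) (by positivity)
      calc x i j ^ 2 = r n ^ 2 *
            (t 0 * cellScore S (W n) 0 i j + t 1 * cellScore S (W n) 1 i j) ^ 2 := by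
            rw [hx]; ring
        _ ≤ r n ^ 2 * (‖t‖ ^ 2 * (2 * (K * (ε * E)))) := by
            refine mul_le_mul_of_nonneg_left (hcs.trans ?_) (sq_nonneg _)
            have := hn i
            gcongr
        _ = (2 * ‖t‖ ^ 2 * K * ε) * (r n ^ 2 * E) := by ring
        _ ≤ (2 * ‖t‖ ^ 2 * K * ε) * |B| := mul_le_mul_of_nonneg_left hrB (by positivity)
        _ = (2 * ‖t‖ ^ 2 * K * |B|) * ε := by ring
        _ ≤ (2 * ‖t‖ ^ 2 * K * |B| + 1) * ε := by
            exact mul_le_mul_of_nonneg_right (by linarith) hε0.le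
        _ = δ ^ 2 := mul_div_cancel₀ _ (by positivity)
    have hmean : ∀ i, ∑ j, cellProb S' j * x i j = 0 := by
      intro i
      have h0 := sum_mul_cellScore hS (cellProb_rotateWord hS') (W n) 0 i
      have h1 := sum_mul_cellScore hS (cellProb_rotateWord hS') (W n) 1 i
      have hterm : ∀ j, cellProb S' j * x i j =
          r n * t 0 * (cellProb S' j * cellScore S (W n) 0 i j) +
            r n * t 1 * (cellProb S' j * cellScore S (W n) 1 i j) := fun j => by
        rw [hx]; ring
      simp only [hterm]
      rw [Finset.sum_add_distrib, ← Finset.mul_sum, ← Finset.mul_sum, h0, h1]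
      ring
    have hvarx : ∑ i, ∑ j, cellProb S' j * x i j ^ 2 =
        r n ^ 2 * upsilonOneSq S S' (W n) * ‖t‖ ^ 2 := by
      rw [upsilonOneSq_eq hS hS', scoreVariance, Finset.mul_sum, Finset.sum_mul]
      refine Finset.sum_congr rfl fun i _ => ?_
      have h := fun c c' =>
        sum_mul_cellScore_mul_cellScore hS (cellProb_rotateWord hS') (W n) c c' i
      have hterm : ∀ j, cellProb S' j * x i j ^ 2 =
          r n ^ 2 * t 0 ^ 2 *
            (cellProb S' j * (cellScore S (W n) 0 i j * cellScore S (W n) 0 i j)) +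
          r n ^ 2 * (2 * t 0 * t 1) *
            (cellProb S' j * (cellScore S (W n) 0 i j * cellScore S (W n) 1 i j)) +
          r n ^ 2 * t 1 ^ 2 *
            (cellProb S' j * (cellScore S (W n) 1 i j * cellScore S (W n) 1 i j)) := fun j => by
        rw [hx]; ring
      simp only [hterm]
      rw [Finset.sum_add_distrib, Finset.sum_add_distrib, ← Finset.mul_sum, ← Finset.mul_sum,
        ← Finset.mul_sum, h, h, h, if_pos rfl, if_neg zero_ne_one, if_pos rfl, ht]
      ring
    have hest := norm_prod_sum_mul_exp_sub_le (fun j => (cellProb_pos hS' j).le)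
      (sum_cellProb hS') hmean hδ0.le (min_le_left _ _) hbound
    rw [hvarx, ← (hN n).charFun_score (W n) hS hS' (r n) t] at hest
    rw [dist_zero_right]
    refine hest.trans_lt ?_
    have hV : r n ^ 2 * upsilonOneSq S S' (W n) * ‖t‖ ^ 2 ≤ K' * |B| * ‖t‖ ^ 2 := by
      refine mul_le_mul_of_nonneg_right ?_ (sq_nonneg _)
      rw [upsilonOneSq_eq hS hS']
      calc r n ^ 2 * scoreVariance (cellProb S') S (W n) ≤ r n ^ 2 * (K' * E) :=
            mul_le_mul_of_nonneg_left (hvar n (W n)) (sq_nonneg _)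
        _ = K' * (r n ^ 2 * E) := by ring
        _ ≤ K' * |B| := mul_le_mul_of_nonneg_left hrB hK'.le
    calc 2 * δ * (r n ^ 2 * upsilonOneSq S S' (W n) * ‖t‖ ^ 2)
        ≤ 2 * δ * (K' * |B| * ‖t‖ ^ 2) := mul_le_mul_of_nonneg_left hV (by positivity)
      _ ≤ δ * D := by rw [hD]; nlinarith
      _ ≤ η / (2 * D) * D := mul_le_mul_of_nonneg_right (min_le_right _ _) hDpos.le
      _ = η / 2 := by field_simp
      _ < η := by linarith
  obtain ⟨n₀, hn₀⟩ := eventually_atTop.1 hgoal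
  exact ⟨n₀, fun n hn => hn₀ n hn.le⟩

end Asymptotics

/-! ### Limit laws of the detector -/

section Detector

variable {m : ℕ} {S S' : Matrix (Fin m) (Fin m) ℂ} {W : (n : ℕ) → Matrix (Fin m) (Fin n) ℂ}
  {Ω : ℕ → Type*} [∀ n, MeasurableSpace (Ω n)] {P : (n : ℕ) → Measure (Ω n)}
  [∀ n, IsProbabilityMeasure (P n)] {N : (n : ℕ) → Ω n → Matrix (Fin m) (Fin n) ℂ}

lemma upsilonSq_pos (hS : S.PosDef) {n : ℕ} {V : Matrix (Fin m) (Fin n) ℂ} (hV : V ≠ 0) :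
    0 < upsilonSq S V := by
  rw [upsilonSq_eq hS]
  exact scoreVariance_pos hS (cellProb_pos hS) hV

lemma upsilonOneSq_pos (hS : S.PosDef) (hS' : S'.PosDef) {n : ℕ}
    {V : Matrix (Fin m) (Fin n) ℂ} (hV : V ≠ 0) : 0 < upsilonOneSq S S' V := by
  rw [upsilonOneSq_eq hS hS']
  exact scoreVariance_pos hS (cellProb_pos hS') hV

theorem tendsto_integral_normalizedScore_sub (hS : S.PosDef) (hS' : S'.PosDef)
    (hW : ∀ᶠ n in atTop, W n ≠ 0)
    (hneg : ∀ ε : ℝ, 0 < ε → ∀ᶠ n in atTop, ∀ i : Fin n,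
      columnEnergy (W n) i ≤ ε * ∑ l, columnEnergy (W n) l)
    (hN : ∀ n, IsCircularGaussianNoise (N n) S' (P n)) (f : EuclideanSpace ℝ (Fin 2) →ᵇ ℝ) :
    Tendsto (fun n => ∫ ω, f (normalizedScore S (W n) (samples (N n ω))) ∂(P n) -
      ∫ x, f x ∂(multivariateGaussian 0 ((upsilonOneSq S S' (W n) / upsilonSq S (W n)) •
        (1 : Matrix (Fin 2) (Fin 2) ℝ)))) atTop (𝓝 0) := by
  obtain ⟨A, hA, hAE⟩ := exists_sum_columnEnergy_le hS (cellProb_pos hS)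
  obtain ⟨K, hK, hKE⟩ := exists_scoreVariance_le S (cellProb_pos hS') (sum_cellProb hS')
  have hmeas : ∀ n, AEMeasurable (fun ω => normalizedScore S (W n) (samples (N n ω))) (P n) :=
    fun n => (hN n).aemeasurable_comp_samples hS' fun Y => normalizedScore S (W n) Y
  have := fun n => Measure.isProbabilityMeasure_map (hmeas n)
  have hρ : ∀ᶠ n in atTop, upsilonOneSq S S' (W n) / upsilonSq S (W n) ∈ Set.Icc 0 (K * A) := by
    filter_upwards [hW] with n hn
    have h0 := upsilonSq_pos hS hn
    refine ⟨div_nonneg (upsilonOneSq_pos hS hS' hn).le h0.le, ?_⟩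
    rw [div_le_iff₀ h0, upsilonOneSq_eq hS hS', upsilonSq_eq hS, mul_assoc]
    exact (hKE n (W n)).trans (mul_le_mul_of_nonneg_left (hAE n (W n)) hK.le)
  have hr : ∀ᶠ n in atTop,
      (Real.sqrt (upsilonSq S (W n)))⁻¹ ^ 2 * ∑ i, columnEnergy (W n) i ≤ A := by
    filter_upwards [hW] with n hn
    have h0 := upsilonSq_pos hS hn
    rw [inv_pow, Real.sq_sqrt h0.le, inv_mul_le_iff₀ h0, mul_comm, upsilonSq_eq hS]
    exact hAE n (W n)
  have hchar : ∀ t : EuclideanSpace ℝ (Fin 2), Tendsto (fun n =>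
      charFun ((P n).map fun ω => normalizedScore S (W n) (samples (N n ω))) t -
        Complex.exp ((-(upsilonOneSq S S' (W n) / upsilonSq S (W n) * ‖t‖ ^ 2) / 2 : ℝ) : ℂ))
      atTop (𝓝 0) := by
    intro t
    refine (tendsto_charFun_score_sub hS hS' hneg hN hr t).congr' ?_
    filter_upwards [hW] with n hn
    rw [inv_pow, Real.sq_sqrt (upsilonSq_pos hS hn).le, inv_mul_eq_div]
    rfl
  refine (tendsto_integral_sub_multivariateGaussian hρ hchar f).congr fun n => ?_
  rw [integral_map (hmeas n) f.continuous.aestronglyMeasurable]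

theorem tendstoInDistribution_smul_normalizedScore (hS : S.PosDef) (hS' : S'.PosDef)
    (hW : ∀ᶠ n in atTop, W n ≠ 0)
    (hneg : ∀ ε : ℝ, 0 < ε → ∀ᶠ n in atTop, ∀ i : Fin n,
      columnEnergy (W n) i ≤ ε * ∑ l, columnEnergy (W n) l)
    (hN : ∀ n, IsCircularGaussianNoise (N n) S' (P n)) :
    TendstoInDistribution
      (fun n ω => Real.sqrt (upsilonSq S (W n) / upsilonOneSq S S' (W n)) •
        normalizedScore S (W n) (samples (N n ω)))
      atTop id P (stdGaussian (EuclideanSpace ℝ (Fin 2))) where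
  forall_aemeasurable n := (hN n).aemeasurable_comp_samples hS' fun Y =>
    Real.sqrt (upsilonSq S (W n) / upsilonOneSq S S' (W n)) • normalizedScore S (W n) Y
  aemeasurable_limit := aemeasurable_id
  tendsto := by
    obtain ⟨A, hA, hAE⟩ := exists_sum_columnEnergy_le hS (cellProb_pos hS')
    refine ProbabilityMeasure.tendsto_iff_tendsto_charFun.2 fun t => ?_
    set r : ℕ → ℝ := fun n => Real.sqrt (upsilonSq S (W n) / upsilonOneSq S S' (W n)) *
      (Real.sqrt (upsilonSq S (W n)))⁻¹ with hr
    have hr2 : ∀ᶠ n in atTop, r n ^ 2 = (upsilonOneSq S S' (W n))⁻¹ := by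
      filter_upwards [hW] with n hn
      have h0 := upsilonSq_pos hS hn
      have h1 := upsilonOneSq_pos hS hS' hn
      rw [hr, mul_pow, inv_pow, Real.sq_sqrt h0.le, Real.sq_sqrt (div_pos h0 h1).le]
      field_simp
    have hbound : ∀ᶠ n in atTop, r n ^ 2 * ∑ i, columnEnergy (W n) i ≤ A := by
      filter_upwards [hW, hr2] with n hn hrn
      have h1 := upsilonOneSq_pos hS hS' hn
      rw [hrn, inv_mul_le_iff₀ h1, mul_comm, upsilonOneSq_eq hS hS']
      exact hAE n (W n)
    have h := (tendsto_charFun_score_sub hS hS' hneg hN hbound t).add_const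
      (Complex.exp ((-(‖t‖ ^ 2) / 2 : ℝ) : ℂ))
    rw [zero_add] at h
    have hlim : charFun ((stdGaussian (EuclideanSpace ℝ (Fin 2))).map id) t =
        Complex.exp ((-(‖t‖ ^ 2) / 2 : ℝ) : ℂ) := by
      rw [Measure.map_id, charFun_stdGaussian]
      push_cast
      rfl
    change Tendsto _ atTop (𝓝 (charFun ((stdGaussian (EuclideanSpace ℝ (Fin 2))).map id) t))
    rw [hlim]
    refine h.congr' ?_
    filter_upwards [hW, hr2] with n hn hrn
    rw [hrn, inv_mul_cancel₀ (upsilonOneSq_pos hS hS' hn).ne', one_mul, sub_add_cancel]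
    have hfun : (fun ω => WithLp.toLp 2 (r n • score S (W n) (samples (N n ω)) 0)) =
        fun ω => Real.sqrt (upsilonSq S (W n) / upsilonOneSq S S' (W n)) •
          normalizedScore S (W n) (samples (N n ω)) := by
      funext ω
      rw [normalizedScore, ← WithLp.toLp_smul, smul_smul]
    rw [hfun]
    rfl

theorem tendstoInDistribution_mul_raoStatistic (hS : S.PosDef) (hS' : S'.PosDef)
    (hW : ∀ᶠ n in atTop, W n ≠ 0)
    (hneg : ∀ ε : ℝ, 0 < ε → ∀ᶠ n in atTop, ∀ i : Fin n,
      columnEnergy (W n) i ≤ ε * ∑ l, columnEnergy (W n) l)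
    (hN : ∀ n, IsCircularGaussianNoise (N n) S' (P n)) :
    TendstoInDistribution
      (fun n ω => upsilonSq S (W n) / upsilonOneSq S S' (W n) *
        raoStatistic S (W n) (samples (N n ω)))
      atTop id P (chiSquared 2) := by
  have hg : Continuous fun x : EuclideanSpace ℝ (Fin 2) => ∑ i, x i ^ 2 := by fun_prop
  refine tendstoInDistribution_congr_eventually
    ((tendstoInDistribution_smul_normalizedScore hS hS' hW hneg hN).continuous_comp hg)
    (fun n => (hN n).aemeasurable_comp_samples hS' fun Y =>
      upsilonSq S (W n) / upsilonOneSq S S' (W n) * raoStatistic S (W n) Y) ?_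
    aemeasurable_id ?_
  · filter_upwards [hW] with n hn
    funext ω
    have hpos := div_pos (upsilonSq_pos hS hn) (upsilonOneSq_pos hS hS' hn)
    rw [raoStatistic_eq hS hn]
    simp only [Function.comp_apply, Fin.sum_univ_two, PiLp.smul_apply, smul_eq_mul, mul_pow,
      Real.sq_sqrt hpos.le]
    ring
  · rw [Measure.map_id]
    rfl

/-- The rescaled statistic has a tail function that converges pointwise, hence uniformly, to the
exponential tail; undoing the scaling only reparametrizes the threshold. -/
theorem eventually_abs_falseAlarm_sub_exp_lt (hS : S.PosDef) (hS' : S'.PosDef)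
    (hW : ∀ᶠ n in atTop, W n ≠ 0)
    (hneg : ∀ ε : ℝ, 0 < ε → ∀ᶠ n in atTop, ∀ i : Fin n,
      columnEnergy (W n) i ≤ ε * ∑ l, columnEnergy (W n) l)
    (hN : ∀ n, IsCircularGaussianNoise (N n) S' (P n)) {ε : ℝ} (hε : 0 < ε) :
    ∀ᶠ n in atTop, ∀ γ : ℝ, 0 ≤ γ →
      |(P n).real {ω | γ < raoStatistic S (W n) (samples (N n ω))} -
        Real.exp (-(upsilonSq S (W n) * γ / (2 * upsilonOneSq S S' (W n))))| < ε := by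
  have hdist := tendstoInDistribution_mul_raoStatistic hS hS' hW hneg hN
  set X : (n : ℕ) → Ω n → ℝ := fun n ω => upsilonSq S (W n) / upsilonOneSq S S' (W n) *
    raoStatistic S (W n) (samples (N n ω)) with hX
  have hXm := hdist.forall_aemeasurable
  have hprob := fun n => Measure.isProbabilityMeasure_map (hXm n)
  have hlim : ∀ g, 0 ≤ g → Tendsto (fun n => ((P n).map (X n)).real (Set.Ioi g)) atTop
      (𝓝 (Real.exp (-g / 2))) := by
    intro g hg
    have hatom : chiSquared 2 (frontier (Set.Ioi g)) = 0 := by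
      rw [frontier_Ioi]
      exact chiSquared_two_singleton hg
    have h : Tendsto (fun n => (P n).map (X n) (Set.Ioi g)) atTop
        (𝓝 (chiSquared 2 (Set.Ioi g))) := by
      simpa using ProbabilityMeasure.tendsto_measure_of_null_frontier_of_tendsto' hdist.tendsto
        (E := Set.Ioi g) (by simpa using hatom)
    rw [← chiSquared_two_real_Ioi hg]
    exact (ENNReal.tendsto_toReal (measure_ne_top _ _)).comp h
  have hunif := eventually_abs_sub_exp_lt_of_antitone
    (F := fun n g => ((P n).map (X n)).real (Set.Ioi g))
    (fun n g g' h => measureReal_mono (Set.Ioi_subset_Ioi h)) (fun n g => measureReal_nonneg)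
    hlim hε
  filter_upwards [hunif, hW] with n hn hWn γ hγ
  have h0 := upsilonSq_pos hS hWn
  have h1 := upsilonOneSq_pos hS hS' hWn
  have h := hn (upsilonSq S (W n) / upsilonOneSq S S' (W n) * γ) (by positivity)
  rw [measureReal_def, Measure.map_apply_of_aemeasurable (hXm n) measurableSet_Ioi,
    ← measureReal_def] at h
  have hset : X n ⁻¹' Set.Ioi (upsilonSq S (W n) / upsilonOneSq S S' (W n) * γ) =
      {ω | γ < raoStatistic S (W n) (samples (N n ω))} := by
    ext ω
    exact mul_lt_mul_iff_right₀ (div_pos h0 h1)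
  have hexp : -(upsilonSq S (W n) / upsilonOneSq S S' (W n) * γ) / 2 =
      -(upsilonSq S (W n) * γ / (2 * upsilonOneSq S S' (W n))) := by
    field_simp
  rwa [hset, hexp] at h

end Detector

end OneBit

theorem theorem1 {m : ℕ}
    -- the covariance assumed by the detector and the true noise covariance
    (S S' : Matrix (Fin m) (Fin m) ℂ) (hS : S.PosDef) (hS' : S'.PosDef)
    -- for every number of samples, the known signal matrix; no column dominates asymptotically
    (W : (n : ℕ) → Matrix (Fin m) (Fin n) ℂ) (hW : ∀ᶠ n in atTop, W n ≠ 0)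
    (hneg : ∀ ε : ℝ, 0 < ε → ∀ᶠ n in atTop, ∀ i : Fin n,
      columnEnergy (W n) i ≤ ε * ∑ l, columnEnergy (W n) l)
    -- for every number of samples, the noise matrix, with the true covariance
    {Ω : ℕ → Type*} [∀ n, MeasurableSpace (Ω n)] (P : (n : ℕ) → Measure (Ω n))
    [∀ n, IsProbabilityMeasure (P n)]
    (N : (n : ℕ) → Ω n → Matrix (Fin m) (Fin n) ℂ)
    (hN : ∀ n, IsCircularGaussianNoise (N n) S' (P n)) :
    -- exact statements for every number of samples
    (∀ n, W n ≠ 0 →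
      0 < upsilonSq S (W n) ∧ 0 < upsilonOneSq S S' (W n) ∧
      upsilonSq S (W n) =
        ((delta₂ S (W n))ᵀ * delta₂ S (W n) * (cellMatrix S)⁻¹).trace ∧
      upsilonOneSq S S' (W n) =
        ((delta₂ S (W n))ᵀ * delta₂ S (W n) * mismatchMatrix S S').trace ∧
      (∀ Y : Fin n → Fin m ⊕ Fin m → ℝ, raoStatistic S (W n) Y =
        normalizedScore S (W n) Y 0 ^ 2 + normalizedScore S (W n) Y 1 ^ 2) ∧
      (∀ c : Fin 2, MemLp (fun ω => normalizedScore S (W n) (samples (N n ω)) c) 2 (P n)) ∧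
      (∀ c : Fin 2, ∫ ω, normalizedScore S (W n) (samples (N n ω)) c ∂(P n) = 0) ∧
      (∀ c c' : Fin 2, ∫ ω, normalizedScore S (W n) (samples (N n ω)) c *
          normalizedScore S (W n) (samples (N n ω)) c' ∂(P n) =
        ((upsilonOneSq S S' (W n) / upsilonSq S (W n)) •
          (1 : Matrix (Fin 2) (Fin 2) ℝ)) c c')) ∧
    -- the law of `w` is asymptotically the normal law with mean 0 and covariance `(υ₁²/υ²) I₂`
    (∀ f : EuclideanSpace ℝ (Fin 2) →ᵇ ℝ,
      Tendsto (fun n => ∫ ω, f (normalizedScore S (W n) (samples (N n ω))) ∂(P n) -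
        ∫ x, f x ∂(multivariateGaussian 0 ((upsilonOneSq S S' (W n) / upsilonSq S (W n)) •
          (1 : Matrix (Fin 2) (Fin 2) ℝ)))) atTop (𝓝 0)) ∧
    TendstoInDistribution
      (fun n ω => Real.sqrt (upsilonSq S (W n) / upsilonOneSq S S' (W n)) •
        normalizedScore S (W n) (samples (N n ω)))
      atTop id P (stdGaussian (EuclideanSpace ℝ (Fin 2))) ∧
    -- `(υ²/υ₁²) T_R` is asymptotically chi-square with two degrees of freedom
    TendstoInDistribution
      (fun n ω => upsilonSq S (W n) / upsilonOneSq S S' (W n) *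
        raoStatistic S (W n) (samples (N n ω)))
      atTop id P (chiSquared 2) ∧
    -- the false-alarm probability, uniformly in the threshold
    (∀ ε : ℝ, 0 < ε → ∀ᶠ n in atTop, ∀ γ : ℝ, 0 ≤ γ →
      |(P n).real {ω | γ < raoStatistic S (W n) (samples (N n ω))} -
        Real.exp (-(upsilonSq S (W n) * γ / (2 * upsilonOneSq S S' (W n))))| < ε) := by
  refine ⟨fun n hn => ?_, tendsto_integral_normalizedScore_sub hS hS' hW hneg hN,
    tendstoInDistribution_smul_normalizedScore hS hS' hW hneg hN,
    tendstoInDistribution_mul_raoStatistic hS hS' hW hneg hN,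
    fun ε hε => eventually_abs_falseAlarm_sub_exp_lt hS hS' hW hneg hN hε⟩
  refine ⟨upsilonSq_pos hS hn, upsilonOneSq_pos hS hS' hn, ?_, ?_, raoStatistic_eq hS hn,
    fun c => (hN n).memLp_comp_samples hS' fun Y => normalizedScore S (W n) Y c,
    (hN n).integral_normalizedScore (W n) hS hS', (hN n).integral_normalizedScore_mul (W n) hS hS'⟩
  · rw [upsilonSq_eq hS, trace_delta₂_inv_cellMatrix hS]
  · rw [upsilonOneSq_eq hS hS', trace_delta₂_mismatchMatrix hS hS']
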